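/- Let $M$ be a $d$-dimensional smooth manifold and let $h\in C^\infty(T^*M,\mathbb R)$ be even and strictly convex on each fibre $T_x^*M$, with $x\mapsto h(x,0)$ bounded from above. Suppose $h$ is hyperregular, i.e. its fibre derivative $\mathcal D_Fh:T^*M\to TM$, $\mathcal D_Fh(x,\xi)=(x,D h_x(\xi))$ with $h_x:=h|_{T_x^*M}$, is a diffeomorphism. Write $(\mathcal D_Fh)^{-1}(x,v)=(x,\xi_h(x,v))$ and $E_h:=h\circ(\mathcal D_Fh)^{-1}:TM\to\mathbb R$. Let $E\in\mathbb R$ and $\widetilde M:=M\setminus\{x: h(x,0)\ge E\}$. For $x\in\widetilde M$ and $0\ne v\in T_xM$ put $$\ell_{h,E}(x,v):=\xi_h(x,\tilde v)\cdot v,$$ where $\tilde v$ is the positive multiple of $v$ with $E_h(x,\tilde v)=E$, and put $\ell_{h,E}(x,0):=0$. Let $a<b$. A curve $\gamma:[a,b]\to\widetilde M$ is regular if it is $C^2$ and $\dot\gamma(t)\neq0$ for all $t\in[a,b]$. It is a geodesic on $\widetilde M$ with respect to $\ell_{h,E}$ if it is regular and is a critical point of the length $s(\gamma)=\int_a^b\ell_{h,E}(\gamma(t),\dot\gamma(t))\,dt$,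 i.e. $\frac{d}{du}\big|_{u=0}s(c(\cdot,u))=0$ for every $\delta>0$ and every $C^2$ map $c:[a,b]\times(-\delta,\delta)\to\widetilde M$ such that $c(\cdot,0)=\gamma$, every $c(\cdot,u)$ is regular, and $c(a,u)=\gamma(a)$, $c(b,u)=\gamma(b)$ for all $u$. A base integral curve of the Hamiltonian vector field $X_h$ is the projection to $M$ of an integral curve of $X_h$ in $T^*M$, where $T^*M$ carries its canonical symplectic structure, so that $X_h=(\partial h/\partial p,-\partial h/\partial q)$ in canonical coordinates $(q,p)$. Then: (a) If $\gamma_0:[a,b]\to\widetilde M$ is a base integral curve of $X_h$ with energy $E$, i.e. $E_h(\gamma_0(t),\dot\gamma_0(t))=E$ for all $t\in[a,b]$, then $\gamma_0$ is a geodesic on $\widetilde M$ with respect to $\ell_{h,E}$. (b) Conversely, if $\gamma_0:[a,b]\to\widetilde M$ is a geodesic on $\widetilde M$ with respect to $\ell_{h,E}$ with energy $E_h(\gamma_0(t),\dot\gamma_0(t))=E$ for all $t\in[a,b]$, then $\gamma_0$ is a base integral curve of $X_h$. -/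

import Mathlib

open Set Bundle
open scoped Manifold ContDiff Topology

namespace Maupertuis

noncomputable section

/-! ### Linear algebra: `V ≅ V**` -/

/-- The vector `v` of a finite-dimensional space `V` that corresponds to the element `φ` of the
bidual under the canonical isomorphism `V ≅ V**`, i.e. `φ η = η v` for all `η`. -/
def vectorOfBidual {V : Type*} [AddCommGroup V] [Module ℝ V] [TopologicalSpace V]
    (φ : (V →L[ℝ] ℝ) →L[ℝ] ℝ) : V :=
  haveI : Nonempty V := ⟨0⟩
  Classical.epsilon fun v : V => ∀ η : V →L[ℝ] ℝ, φ η = η v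

/-- On finite-dimensional spaces the vector in `vectorOfBidual` does exist. -/
theorem vectorOfBidual_spec {V : Type*} [AddCommGroup V] [Module ℝ V] [TopologicalSpace V]
    [IsTopologicalAddGroup V] [ContinuousSMul ℝ V] [T2Space V] [FiniteDimensional ℝ V]
    (φ : (V →L[ℝ] ℝ) →L[ℝ] ℝ) (η : V →L[ℝ] ℝ) : η (vectorOfBidual φ) = φ η := by
  let g : Module.Dual ℝ (Module.Dual ℝ V) :=
    φ.toLinearMap ∘ₗ (LinearMap.toContinuousLinearMap (𝕜 := ℝ) (E := V) (F' := ℝ)).toLinearMap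
  have hex : ∃ v : V, ∀ η : V →L[ℝ] ℝ, φ η = η v := by
    refine ⟨(Module.evalEquiv ℝ V).symm g, fun η => ?_⟩
    have := Module.apply_evalEquiv_symm_apply (R := ℝ) (M := V) η.toLinearMap g
    exact this.symm
  have : Nonempty V := ⟨0⟩
  exact (Classical.epsilon_spec hex η).symm

/-! ### The cotangent bundle -/

/-- The model space `ℝ^d`. -/
abbrev Model (d : ℕ) : Type := EuclideanSpace ℝ (Fin d)

/-- The cotangent space `T*_x M`. -/
abbrev CotangentSpace (d : ℕ) {M : Type*} [TopologicalSpace M] [ChartedSpace (Model d) M]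
    (x : M) : Type :=
  TangentSpace (𝓡 d) x →L[ℝ] ℝ

/-- The cotangent bundle `T*M`, with the smooth vector bundle structure of the Hom-bundle
`Hom(TM, ℝ)`. -/
abbrev CotangentBundle (d : ℕ) (M : Type*) [TopologicalSpace M] [ChartedSpace (Model d) M] :
    Type _ :=
  TotalSpace (Model d →L[ℝ] ℝ) (fun x : M => TangentSpace (𝓡 d) x →L[ℝ] ℝ)

/-- The model with corners of `T*M`, with model space `ℝ^d × (ℝ^d)*`. -/
abbrev cotangentModel (d : ℕ) :
    ModelWithCorners ℝ (Model d × (Model d →L[ℝ] ℝ)) (ModelProd (Model d) (Model d →L[ℝ] ℝ)) :=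
  (𝓡 d).prod 𝓘(ℝ, Model d →L[ℝ] ℝ)

section Hamiltonian

variable {d : ℕ} {M : Type*} [TopologicalSpace M] [ChartedSpace (Model d) M]
  [IsManifold (𝓡 d) ∞ M]

/-! ### Hyperregular Hamilton functions -/

/-- The derivative `Dh_x(ξ) ∈ (T*_x M)* = T_x M` of the restriction `h_x` of `h` to `T*_x M`. -/
def fibreDerivAt (h : CotangentBundle d M → ℝ) (x : M) (ξ : CotangentSpace d x) :
    TangentSpace (𝓡 d) x :=
  vectorOfBidual (fderiv ℝ (fun η : CotangentSpace d x => h ⟨x, η⟩) ξ)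

/-- The fibre derivative `D_F h : T*M → TM`, `(x, ξ) ↦ (x, Dh_x(ξ))`. -/
def fibreDeriv (h : CotangentBundle d M → ℝ) (p : CotangentBundle d M) :
    TangentBundle (𝓡 d) M :=
  ⟨p.proj, fibreDerivAt h p.proj p.snd⟩

/-- `h` is hyperregular: its fibre derivative is a (smooth) diffeomorphism `T*M → TM`. -/
def Hyperregular (h : CotangentBundle d M → ℝ) : Prop :=
  ∃ Φ : Diffeomorph (cotangentModel d) (𝓡 d).tangent
      (CotangentBundle d M) (TangentBundle (𝓡 d) M) ∞,
    ∀ p, Φ p = fibreDeriv h p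

/-- `ξ_h(x, v) ∈ T*_x M`, the fibre component of `(D_F h)⁻¹ (x, v)`. -/
def invFibreDeriv (h : CotangentBundle d M → ℝ) (x : M) (v : TangentSpace (𝓡 d) x) :
    CotangentSpace d x :=
  Function.invFun (fibreDerivAt h x) v

/-- For hyperregular `h`, `(x, ξ_h(x, v))` is `(D_F h)⁻¹ (x, v)`. -/
theorem fibreDeriv_invFibreDeriv {h : CotangentBundle d M → ℝ} (hh : Hyperregular h) (x : M)
    (v : TangentSpace (𝓡 d) x) :
    fibreDeriv h ⟨x, invFibreDeriv h x v⟩ = ⟨x, v⟩ := by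
  obtain ⟨Φ, hΦ⟩ := hh
  obtain ⟨⟨y, ξ⟩, hp⟩ := Φ.surjective (⟨x, v⟩ : TangentBundle (𝓡 d) M)
  have hp : fibreDeriv h ⟨y, ξ⟩ = ⟨x, v⟩ := (hΦ _).symm.trans hp
  obtain rfl : y = x := congrArg TotalSpace.proj hp
  have hv : fibreDerivAt h y ξ = v := by
    simpa [fibreDeriv] using hp
  have := Function.invFun_eq (f := fibreDerivAt h y) ⟨ξ, hv⟩
  exact congrArg (TotalSpace.mk' (Model d) y) this

/-- The energy function `E_h = h ∘ (D_F h)⁻¹` on `TM`. -/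
def energy (h : CotangentBundle d M → ℝ) (x : M) (v : TangentSpace (𝓡 d) x) : ℝ :=
  h ⟨x, invFibreDeriv h x v⟩

/-- The open set `M̃ = M \ {x | h(x, 0) ≥ E}`. -/
def regularSet (h : CotangentBundle d M → ℝ) (E : ℝ) : Set M :=
  {x | h ⟨x, 0⟩ ≥ E}ᶜ

/-! ### The Finsler function of `h` at energy `E` -/

/-- For `x ∈ M̃` and `v ≠ 0`: the number `μ > 0` with `E_h(x, μ v) = E`. -/
def energyScale (h : CotangentBundle d M → ℝ) (E : ℝ) (x : M) (v : TangentSpace (𝓡 d) x) : ℝ :=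
  Classical.epsilon fun μ : ℝ => 0 < μ ∧ energy h x (μ • v) = E

/-- The function `ℓ_{h,E}(x, v) = ξ_h(x, ṽ) · v`, where `ṽ` is the positive multiple of `v` with
`E_h(x, ṽ) = E` (it vanishes for `v = 0`). Only its values at points `x ∈ M̃` are relevant. -/
def finslerFunction (h : CotangentBundle d M → ℝ) (E : ℝ) (x : M) (v : TangentSpace (𝓡 d) x) : ℝ :=
  invFibreDeriv h x (energyScale h E x v • v) v

/-! ### The Hamiltonian vector field -/

/-- The preferred charts of `T*M` are the cotangent lifts of the preferred charts of `M`: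
`(x, ξ) ↦ (φ x, ξ ∘ D(φ⁻¹)(φ x))`. -/
theorem extChartAt_cotangentBundle (p y : CotangentBundle d M)
    (hy : y.1 ∈ (chartAt (Model d) p.1).source) :
    extChartAt (cotangentModel d) p y =
      (extChartAt (𝓡 d) p.1 y.1,
        (show Model d →L[ℝ] ℝ from y.2.comp
          (mfderivWithin 𝓘(ℝ, Model d) (𝓡 d) (extChartAt (𝓡 d) p.1).symm (range (𝓡 d))
            (extChartAt (𝓡 d) p.1 y.1)))) := by
  have h3 := TangentBundle.symmL_trivializationAt (I := 𝓡 d) (M := M) hy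
  rw [← h3]
  ext i
  · simp [extChartAt, hom_chart]
  · simp [extChartAt, hom_chart, ContinuousLinearMap.inCoordinates]

/-- The differential of `h` at `p ∈ T*M` in the canonical coordinates `(q, p)` around that point,
given by the preferred chart there. -/
def coordDifferential (h : CotangentBundle d M → ℝ) (p : CotangentBundle d M) :
    (Model d × (Model d →L[ℝ] ℝ)) →L[ℝ] ℝ :=
  fderiv ℝ (h ∘ (extChartAt (cotangentModel d) p).symm) (extChartAt (cotangentModel d) p p)

/-- The Hamiltonian vector field `X_h = (∂h/∂p, -∂h/∂q)` on `T*M`, in canonical coordinates.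
(A tangent vector at a point is given by its coordinates in the preferred chart at that point.) -/
def hamiltonianVectorField (h : CotangentBundle d M → ℝ) (p : CotangentBundle d M) :
    TangentSpace (cotangentModel d) p :=
  show Model d × (Model d →L[ℝ] ℝ) from
    (vectorOfBidual ((coordDifferential h p).comp (ContinuousLinearMap.inr ℝ _ _)),
      -(coordDifferential h p).comp (ContinuousLinearMap.inl ℝ _ _))

/-- The symplectic form `dq ∧ dp` in canonical coordinates. -/
def canonicalSymplecticForm {d : ℕ} (u w : Model d × (Model d →L[ℝ] ℝ)) : ℝ :=
  w.2 u.1 - u.2 w.1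

/-- `X_h` is the vector field with `ω(X_h, ·) = dh`. -/
theorem canonicalSymplecticForm_hamiltonianVectorField (h : CotangentBundle d M → ℝ)
    (p : CotangentBundle d M) (w : Model d × (Model d →L[ℝ] ℝ)) :
    canonicalSymplecticForm (hamiltonianVectorField h p) w = coordDifferential h p w := by
  obtain ⟨b, β⟩ := w
  have h1 : canonicalSymplecticForm (hamiltonianVectorField h p) (b, β) =
      β (vectorOfBidual ((coordDifferential h p).comp (ContinuousLinearMap.inr ℝ _ _))) -
        (-(coordDifferential h p).comp (ContinuousLinearMap.inl ℝ _ _)) b := rfl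
  rw [h1, vectorOfBidual_spec]
  simp [← map_add]

/-- `γ : [a, b] → M` is a base integral curve of `X_h`: the projection to `M` of an integral curve
`[a, b] → T*M` of `X_h`. -/
def IsBaseIntegralCurve (h : CotangentBundle d M → ℝ) (a b : ℝ) (γ : ℝ → M) : Prop :=
  ∃ Γ : ℝ → CotangentBundle d M,
    IsMIntegralCurveOn Γ (hamiltonianVectorField h) (Icc a b) ∧
      ∀ t ∈ Icc a b, (Γ t).proj = γ t

end Hamiltonian

/-! ### Finsler geodesics -/

section Geodesics

variable {d : ℕ} {M : Type*} [TopologicalSpace M] [ChartedSpace (Model d) M]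

/-- The velocity of a curve `γ : [a, b] → M` (one-sided at the end points). As for all curves
`[a, b] → M` here, `γ` is a function on `ℝ` of which only the values on `[a, b]` matter. -/
def velocity (a b : ℝ) (γ : ℝ → M) (t : ℝ) : TangentSpace (𝓡 d) (γ t) :=
  mfderivWithin 𝓘(ℝ, ℝ) (𝓡 d) γ (Icc a b) t (1 : ℝ)

/-- `γ : [a, b] → U` is a regular curve: it is `C²` and its velocity vanishes nowhere. -/
structure IsRegularCurve (d : ℕ) {M : Type*} [TopologicalSpace M] [ChartedSpace (Model d) M]
    (U : Set M) (a b : ℝ) (γ : ℝ → M) : Prop where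
  mapsTo : ∀ t ∈ Icc a b, γ t ∈ U
  contMDiffOn : ContMDiffOn 𝓘(ℝ, ℝ) (𝓡 d) 2 γ (Icc a b)
  velocity_ne_zero : ∀ t ∈ Icc a b, velocity (d := d) a b γ t ≠ 0

/-- The curve length `s_F(γ) = ∫_a^b F(γ, γ̇) dt`. -/
def curveLength (F : (x : M) → TangentSpace (𝓡 d) x → ℝ) (a b : ℝ) (γ : ℝ → M) : ℝ :=
  ∫ t in a..b, F (γ t) (velocity a b γ t)

/-- `c : [a, b] × (-δ, δ) → U` is a regular variation of `γ` with fixed end points. -/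
structure IsRegularVariation (d : ℕ) {M : Type*} [TopologicalSpace M] [ChartedSpace (Model d) M]
    (U : Set M) (a b : ℝ) (γ : ℝ → M) (δ : ℝ) (c : ℝ × ℝ → M) : Prop where
  contMDiffOn : ContMDiffOn 𝓘(ℝ, ℝ × ℝ) (𝓡 d) 2 c (Icc a b ×ˢ Ioo (-δ) δ)
  regular : ∀ u ∈ Ioo (-δ) δ, IsRegularCurve d U a b (fun t => c (t, u))
  center : ∀ t ∈ Icc a b, c (t, 0) = γ t
  left_end : ∀ u ∈ Ioo (-δ) δ, c (a, u) = γ a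
  right_end : ∀ u ∈ Ioo (-δ) δ, c (b, u) = γ b

/-- `γ : [a, b] → U` is a geodesic on the open set `U` with respect to the Finsler function `F`
on `U`: it is a regular curve, and `ds_F|_γ = 0`, i.e. the derivative of the length vanishes along
all regular variations of `γ` in `U` with fixed end points. -/
def IsFinslerGeodesic (F : (x : M) → TangentSpace (𝓡 d) x → ℝ) (U : Set M) (a b : ℝ)
    (γ : ℝ → M) : Prop :=
  IsRegularCurve d U a b γ ∧
    ∀ (δ : ℝ) (c : ℝ × ℝ → M), 0 < δ → IsRegularVariation d U a b γ δ c →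
      HasDerivAt (fun u => curveLength F a b (fun t => c (t, u))) 0 0

end Geodesics

end

end Maupertuis

open Maupertuis

/-!
The curves are compared in the preferred charts of `M`, where `h` becomes a function `H (q, p)` that
is even and strictly convex in `p`, with a `C¹` inverse `p = Ξ (q, v)` of `v = ∂H/∂p`
(`IsLegendreChart`).

*The Finsler function.* By evenness `H (q, ·)` is minimal at `p = 0`, the energy `H (q, Ξ (q, μ v))`
increases from `H (q, 0)` to `∞` along `μ ≥ 0`, and for `H (q, 0) < E` there is exactly one `μ > 0`
of energy `E`. Convexity then shows that `ℓ (q, v) ≥ η v - μ⁻¹ (H (q, η) - E)` for all momenta `η`,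
with equality at the momentum `P` that defines `ℓ` (`IsLegendreChart.le_chartFinsler`): `ℓ` is the
support function of the sublevel set `{H (q, ·) ≤ E}` and `μ⁻¹` is the Lagrange multiplier. Since
`P` and `μ` are continuous, the envelope theorem (`IsLegendreChart.hasFDerivAt_chartFinsler`) gives
`∂ℓ/∂v = P` and `∂ℓ/∂q = -μ⁻¹ ∂H/∂q (q, P)`. At vectors of energy `E` one has `μ = 1`, and these are
the derivatives of `p v - (H (q, p) - E)`.

*First variation.* Consequently, for a variation of a curve of energy `E` with momentum
`p = Ξ (q, q')` and variational field `w`, the derivative of the length integrand is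
`(p w)' - (p' + ∂H/∂q) w` (`first_variation`). The first equation of Hamilton, `q' = ∂H/∂p`, is
the definition of `p`; the second one is `p' + ∂H/∂q = 0`.

*Integral curves are geodesics.* Hamilton's equations hold in every chart of `M`, because changes of
coordinates lift to symplectic maps of `T*M` (`hasDerivWithinAt_cotangentChart`). Hence a base
integral curve is `C²`, and along it the integrand of the first variation is the derivative of the
globally defined function `p w`, which vanishes at the end points
(`isFinslerGeodesic_of_isBaseIntegralCurve`).

*Geodesics are integral curves.* Variations `q + u χ y` with a constant vector `y` and a bump
function `χ`, supported in a parameter interval that the curve maps into one chart, give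
`∫ χ (p' + ∂H/∂q) y = 0` (`integral_mul_hamiltonResidual_eq_zero`). As `p' + ∂H/∂q` is continuous,
it vanishes (`hamiltonResidual_eq_zero`), so that `(γ, ξ_h (γ, γ'))` is an integral curve of `X_h`
(`isBaseIntegralCurve_of_isFinslerGeodesic`).

`TangentSpace (𝓡 d) x` is by definition the model space `ℝ^d`, but it carries different instances
for each `x`. The functions whose names begin with `model` are versions of the given notions that
take and return elements of `ℝ^d`.
-/

namespace Maupertuis

/-! ### Strictly convex Hamilton functions in a chart -/

/-- A strictly convex function lies strictly above its tangent hyperplanes. -/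
theorem add_hasFDerivAt_lt_of_strictConvexOn {F : Type*} [NormedAddCommGroup F] [NormedSpace ℝ F]
    {f : F → ℝ} {f' : F →L[ℝ] ℝ} {p η : F} (hf : StrictConvexOn ℝ univ f)
    (hp : HasFDerivAt f f' p) (hne : η ≠ p) : f p + f' (η - p) < f η := by
  have hg : ConvexOn ℝ univ (f ∘ AffineMap.lineMap (k := ℝ) p η) := by
    simpa using hf.convexOn.comp_affineMap (AffineMap.lineMap (k := ℝ) p η)
  have hd : HasDerivAt (f ∘ AffineMap.lineMap (k := ℝ) p η) (f' (η - p)) 0 := by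
    refine HasFDerivAt.comp_hasDerivAt (0 : ℝ) ?_ AffineMap.hasDerivAt_lineMap
    simpa using hp
  have h1 := hg.le_slope_of_hasDerivAt (mem_univ 0) (mem_univ (1 / 2 : ℝ)) (by norm_num) hd
  have h2 := hf.2 (mem_univ p) (mem_univ η) hne.symm
    (show (0 : ℝ) < 1 / 2 by norm_num) (show (0 : ℝ) < 1 / 2 by norm_num) (by norm_num)
  have h3 : AffineMap.lineMap (k := ℝ) p η (1 / 2 : ℝ) = (1 / 2 : ℝ) • p + (1 / 2 : ℝ) • η := by
    rw [AffineMap.lineMap_apply_module]; norm_num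
  simp only [slope_def_field, Function.comp, h3, AffineMap.lineMap_apply_zero, sub_zero,
    smul_eq_mul] at h1 h2
  rw [le_div_iff₀ (by norm_num)] at h1
  linarith

section Chart

variable {V : Type*} [NormedAddCommGroup V] [NormedSpace ℝ V]

/-- The coordinate form of an even, fibrewise strictly convex, hyperregular Hamilton function:
`H (q, p)` is defined for `q` in the open set `U`, and `Ξ (q, v)` is the momentum `p` whose velocity
`∂H/∂p (q, p)` is `v`. -/
structure IsLegendreChart (U : Set V) (H : V × (V →L[ℝ] ℝ) → ℝ) (Ξ : V × V → V →L[ℝ] ℝ) :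
    Prop where
  isOpen : IsOpen U
  contDiffOn : ContDiffOn ℝ 2 H (U ×ˢ univ)
  strictConvexOn : ∀ q ∈ U, StrictConvexOn ℝ univ fun p => H (q, p)
  even : ∀ q ∈ U, ∀ p, H (q, -p) = H (q, p)
  contDiffOn_inv : ContDiffOn ℝ 1 Ξ (U ×ˢ univ)
  fderiv_inr : ∀ q ∈ U, ∀ v η, fderiv ℝ H (q, Ξ (q, v)) (0, η) = η v

/-- The pairs `(q, v)` over `{H (·, 0) < E}` with `v ≠ 0`, where the Finsler function is
differentiable. -/
def slitDomain (U : Set V) (H : V × (V →L[ℝ] ℝ) → ℝ) (E : ℝ) : Set (V × V) :=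
  {z | z.1 ∈ U ∧ H (z.1, 0) < E ∧ z.2 ≠ 0}

/-- The factor `μ > 0` for which `(q, μ v)` has energy `E`, in coordinates. -/
noncomputable def chartScale (H : V × (V →L[ℝ] ℝ) → ℝ) (Ξ : V × V → V →L[ℝ] ℝ) (E : ℝ)
    (z : V × V) : ℝ :=
  Classical.epsilon fun μ : ℝ => 0 < μ ∧ H (z.1, Ξ (z.1, μ • z.2)) = E

/-- The momentum of the positive multiple of `v` that has energy `E`, in coordinates. -/
noncomputable def chartMomentum (H : V × (V →L[ℝ] ℝ) → ℝ) (Ξ : V × V → V →L[ℝ] ℝ) (E : ℝ)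
    (z : V × V) : V →L[ℝ] ℝ :=
  Ξ (z.1, chartScale H Ξ E z • z.2)

/-- The Finsler function in coordinates. -/
noncomputable def chartFinsler (H : V × (V →L[ℝ] ℝ) → ℝ) (Ξ : V × V → V →L[ℝ] ℝ) (E : ℝ)
    (z : V × V) : ℝ :=
  chartMomentum H Ξ E z z.2

namespace IsLegendreChart

variable {U : Set V} {H : V × (V →L[ℝ] ℝ) → ℝ} {Ξ : V × V → V →L[ℝ] ℝ} {E : ℝ}

theorem contDiffAt (hC : IsLegendreChart U H Ξ) {z : V × (V →L[ℝ] ℝ)} (hz : z.1 ∈ U) :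
    ContDiffAt ℝ 2 H z :=
  hC.contDiffOn.contDiffAt ((hC.isOpen.prod isOpen_univ).mem_nhds ⟨hz, mem_univ _⟩)

theorem hasFDerivAt (hC : IsLegendreChart U H Ξ) {z : V × (V →L[ℝ] ℝ)} (hz : z.1 ∈ U) :
    HasFDerivAt H (fderiv ℝ H z) z :=
  ((hC.contDiffAt hz).differentiableAt (by norm_num)).hasFDerivAt

theorem continuousAt_inv (hC : IsLegendreChart U H Ξ) {z : V × V} (hz : z.1 ∈ U) :
    ContinuousAt Ξ z :=
  hC.contDiffOn_inv.continuousOn.continuousAt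
    ((hC.isOpen.prod isOpen_univ).mem_nhds ⟨hz, mem_univ _⟩)

theorem add_fderiv_lt (hC : IsLegendreChart U H Ξ) {q : V} (hq : q ∈ U) {p η : V →L[ℝ] ℝ}
    (hne : η ≠ p) : H (q, p) + fderiv ℝ H (q, p) (0, η - p) < H (q, η) := by
  have h1 : HasFDerivAt (fun p => H (q, p))
      ((fderiv ℝ H (q, p)).comp (ContinuousLinearMap.inr ℝ V (V →L[ℝ] ℝ))) p :=
    (hC.hasFDerivAt (z := (q, p)) hq).comp p (hasFDerivAt_prodMk_right q p)
  simpa using add_hasFDerivAt_lt_of_strictConvexOn (hC.strictConvexOn q hq) h1 hne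

theorem add_apply_lt (hC : IsLegendreChart U H Ξ) {q : V} (hq : q ∈ U) (v : V) {η : V →L[ℝ] ℝ}
    (hne : η ≠ Ξ (q, v)) : H (q, Ξ (q, v)) + (η - Ξ (q, v)) v < H (q, η) := by
  have := hC.add_fderiv_lt hq hne
  rwa [hC.fderiv_inr q hq] at this

theorem add_apply_le (hC : IsLegendreChart U H Ξ) {q : V} (hq : q ∈ U) (v : V) (η : V →L[ℝ] ℝ) :
    H (q, Ξ (q, v)) + (η - Ξ (q, v)) v ≤ H (q, η) := by
  rcases eq_or_ne η (Ξ (q, v)) with rfl | hne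
  · simp
  · exact (hC.add_apply_lt hq v hne).le

/-- The momentum is determined by its velocity. -/
theorem eq_inv (hC : IsLegendreChart U H Ξ) {q v : V} (hq : q ∈ U) {p : V →L[ℝ] ℝ}
    (hp : ∀ η, fderiv ℝ H (q, p) (0, η) = η v) : p = Ξ (q, v) := by
  by_contra hne
  have h1 := hC.add_apply_lt hq v hne
  have h2 := hC.add_fderiv_lt hq (Ne.symm hne)
  rw [hp] at h2
  simp only [sub_apply] at h1 h2
  linarith

theorem inv_zero (hC : IsLegendreChart U H Ξ) {q : V} (hq : q ∈ U) : Ξ (q, 0) = 0 := by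
  by_contra hne
  have h1 := hC.add_apply_lt hq 0 (η := -Ξ (q, 0)) (by
    intro h
    refine hne (ContinuousLinearMap.ext fun w => ?_)
    have := DFunLike.congr_fun h w
    simp only [neg_apply, zero_apply] at this ⊢
    linarith)
  rw [hC.even q hq] at h1
  simp at h1

/-- The energy increases strictly along the rays of each fibre. -/
theorem energy_lt (hC : IsLegendreChart U H Ξ) {q v : V} (hq : q ∈ U) (hv : v ≠ 0) {m n : ℝ}
    (hm : 0 ≤ m) (hmn : m < n) : H (q, Ξ (q, m • v)) < H (q, Ξ (q, n • v)) := by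
  have hne : Ξ (q, n • v) ≠ Ξ (q, m • v) := by
    intro h
    obtain ⟨η, hη⟩ := SeparatingDual.exists_eq_one (R := ℝ) hv
    have h1 := hC.fderiv_inr q hq (n • v) η
    have h2 := hC.fderiv_inr q hq (m • v) η
    rw [h, h2] at h1
    simp only [map_smul, hη, smul_eq_mul, mul_one] at h1
    exact hmn.ne h1
  have h1 := hC.add_apply_lt hq _ hne
  have h2 := hC.add_apply_lt hq _ hne.symm
  simp only [sub_apply, map_smul, smul_eq_mul] at h1 h2
  have h3 : 0 < (n - m) * (Ξ (q, n • v) v - Ξ (q, m • v) v) := by nlinarith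
  have h4 : 0 < Ξ (q, n • v) v - Ξ (q, m • v) v := by
    rcases pos_and_pos_or_neg_and_neg_of_mul_pos h3 with h | h
    · exact h.2
    · linarith [h.1]
  nlinarith

/-- The energy is unbounded along the rays of each fibre: for every momentum `θ`, the supporting
inequality at `m v` forces `Ξ (q, m v) v` to be almost as large as `θ v` once `m` is large. -/
theorem exists_lt_energy (hC : IsLegendreChart U H Ξ) {q v : V} (hq : q ∈ U) (hv : v ≠ 0) (E : ℝ) :
    ∃ m : ℝ, 0 < m ∧ E < H (q, Ξ (q, m • v)) := by
  obtain ⟨η, hη⟩ := SeparatingDual.exists_eq_one (R := ℝ) hv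
  -- a momentum `θ` with `θ v` so large that it raises the energy above `E`
  set s : ℝ := E - H (q, Ξ (q, v)) + Ξ (q, v) v + 1
  set θ : V →L[ℝ] ℝ := s • η
  have hθ : θ v = s := by simp [θ, hη]
  set D : ℝ := H (q, θ) - H (q, Ξ (q, v))
  set m : ℝ := 1 + |D|
  have hD := le_abs_self D
  have hD' := abs_nonneg D
  have hm : 0 < m := by positivity
  refine ⟨m, hm, ?_⟩
  have h1 := hC.add_apply_le hq v (Ξ (q, m • v))
  have h2 := hC.add_apply_le hq (m • v) θ
  have h3 : H (q, Ξ (q, v)) ≤ H (q, Ξ (q, m • v)) := by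
    rcases hD'.eq_or_lt with h | h
    · have : m = 1 := by simp [m, ← h]
      rw [this, one_smul]
    · have := hC.energy_lt hq hv zero_le_one (show (1 : ℝ) < m by simp only [m]; linarith)
      rw [one_smul] at this
      exact this.le
  simp only [sub_apply, map_smul, smul_eq_mul, hθ] at h1 h2
  have h4 : m * (s - Ξ (q, m • v) v) ≤ D := by simp only [D]; linarith
  have h5 : s - Ξ (q, m • v) v < 1 := by
    by_contra h
    push Not at h
    have : m ≤ m * (s - Ξ (q, m • v) v) := le_mul_of_one_le_right hm.le h
    have : m = 1 + |D| := rfl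
    linarith
  have h6 : s = E - H (q, Ξ (q, v)) + Ξ (q, v) v + 1 := rfl
  linarith

theorem continuousAt_energy (hC : IsLegendreChart U H Ξ) {z : V × V} (hz : z.1 ∈ U) :
    ContinuousAt (fun z : V × V => H (z.1, Ξ z)) z :=
  ContinuousAt.comp (f := fun z : V × V => (z.1, Ξ z)) (g := H)
    (hC.contDiffAt (z := (z.1, Ξ z)) hz).continuousAt
    (continuousAt_fst.prodMk (hC.continuousAt_inv hz))

theorem chartScale_spec (hC : IsLegendreChart U H Ξ) {z : V × V} (hz : z ∈ slitDomain U H E) :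
    0 < chartScale H Ξ E z ∧ H (z.1, chartMomentum H Ξ E z) = E := by
  refine Classical.epsilon_spec (p := fun μ : ℝ => 0 < μ ∧ H (z.1, Ξ (z.1, μ • z.2)) = E) ?_
  obtain ⟨hq, h0, hv⟩ := hz
  obtain ⟨m, hm, hEm⟩ := hC.exists_lt_energy hq hv E
  have hcont : ContinuousOn (fun μ : ℝ => H (z.1, Ξ (z.1, μ • z.2))) (Icc 0 m) := fun μ _ =>
    (ContinuousAt.comp (f := fun μ : ℝ => (z.1, μ • z.2))
      (g := fun z : V × V => H (z.1, Ξ z)) (hC.continuousAt_energy (z := (z.1, μ • z.2)) hq)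
      (by fun_prop)).continuousWithinAt
  have h0' : H (z.1, Ξ (z.1, (0 : ℝ) • z.2)) ≤ E := by rw [zero_smul, hC.inv_zero hq]; exact h0.le
  obtain ⟨μ, hμ, hμE⟩ := intermediate_value_Icc hm.le hcont ⟨h0', hEm.le⟩
  refine ⟨μ, lt_of_le_of_ne hμ.1 ?_, hμE⟩
  rintro rfl
  simp only [zero_smul, hC.inv_zero hq] at hμE
  exact h0.ne hμE

theorem chartScale_eq (hC : IsLegendreChart U H Ξ) {z : V × V} (hz : z ∈ slitDomain U H E)
    {m : ℝ} (hm : 0 < m) (hE : H (z.1, Ξ (z.1, m • z.2)) = E) : chartScale H Ξ E z = m := by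
  obtain ⟨h1, h2⟩ := hC.chartScale_spec hz
  rcases lt_trichotomy (chartScale H Ξ E z) m with h | h | h
  · exact absurd (h2.trans hE.symm) (hC.energy_lt hz.1 hz.2.2 h1.le h).ne
  · exact h
  · exact absurd (hE.trans h2.symm) (hC.energy_lt hz.1 hz.2.2 hm.le h).ne

theorem isOpen_slitDomain (hC : IsLegendreChart U H Ξ) (E : ℝ) : IsOpen (slitDomain U H E) := by
  rw [isOpen_iff_mem_nhds]
  rintro z ⟨hq, h0, hv⟩
  have h1 : ∀ᶠ w : V × V in 𝓝 z, w.1 ∈ U := continuousAt_fst.eventually (hC.isOpen.mem_nhds hq)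
  have h2 : ∀ᶠ w : V × V in 𝓝 z, w.2 ≠ 0 := continuousAt_snd.eventually_ne hv
  have h3 : ContinuousAt (fun w : V × V => H (w.1, 0)) z :=
    ContinuousAt.comp (f := fun w : V × V => (w.1, (0 : V →L[ℝ] ℝ))) (g := H)
      (hC.contDiffAt (z := (z.1, 0)) hq).continuousAt (by fun_prop)
  filter_upwards [h1, h2, h3.eventually_lt_const h0] with w a b c using ⟨a, c, b⟩

theorem continuousAt_chartScale (hC : IsLegendreChart U H Ξ) {z : V × V}
    (hz : z ∈ slitDomain U H E) : ContinuousAt (chartScale H Ξ E) z := by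
  obtain ⟨hμ, hμE⟩ := hC.chartScale_spec hz
  have hmem : ∀ᶠ w in 𝓝 z, w ∈ slitDomain U H E := (hC.isOpen_slitDomain E).mem_nhds hz
  have hcont : ∀ m : ℝ, ContinuousAt (fun w : V × V => H (w.1, Ξ (w.1, m • w.2))) z := fun m =>
    ContinuousAt.comp (f := fun w : V × V => (w.1, m • w.2))
      (g := fun z : V × V => H (z.1, Ξ z)) (hC.continuousAt_energy (z := (z.1, m • z.2)) hz.1)
      (by fun_prop)
  rw [ContinuousAt, tendsto_order]
  refine ⟨fun a ha => ?_, fun b hb => ?_⟩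
  · rcases le_or_gt a 0 with ha0 | ha0
    · filter_upwards [hmem] with w hw using ha0.trans_lt (hC.chartScale_spec hw).1
    have h1 := hC.energy_lt hz.1 hz.2.2 ha0.le ha
    filter_upwards [hmem, (hcont a).eventually_lt_const (h1.trans_eq hμE)] with w hw hlt
    by_contra! hle
    obtain ⟨h2, h3⟩ := hC.chartScale_spec hw
    rcases hle.eq_or_lt with h | h
    · rw [chartMomentum, h] at h3; exact hlt.ne h3
    · exact lt_asymm hlt (h3.symm.trans_lt (hC.energy_lt hw.1 hw.2.2 h2.le h))
  · have hb0 := hμ.trans hb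
    have h1 := hC.energy_lt hz.1 hz.2.2 hμ.le hb
    filter_upwards [hmem, (hcont b).eventually_const_lt (hμE.symm.trans_lt h1)] with w hw hlt
    by_contra! hle
    obtain ⟨h2, h3⟩ := hC.chartScale_spec hw
    rcases hle.eq_or_lt with h | h
    · rw [chartMomentum, ← h] at h3; exact hlt.ne h3.symm
    · exact lt_asymm hlt ((hC.energy_lt hw.1 hw.2.2 hb0.le h).trans_eq h3)

theorem continuousAt_chartMomentum (hC : IsLegendreChart U H Ξ) {z : V × V}
    (hz : z ∈ slitDomain U H E) : ContinuousAt (chartMomentum H Ξ E) z :=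
  ContinuousAt.comp (f := fun w : V × V => (w.1, chartScale H Ξ E w • w.2)) (g := Ξ)
    (hC.continuousAt_inv hz.1)
    (continuousAt_fst.prodMk ((hC.continuousAt_chartScale hz).smul continuousAt_snd))

/-- The Finsler function is the support function of the sublevel set `{H (q, ·) ≤ E}`, in its
Lagrangian form. -/
theorem le_chartFinsler (hC : IsLegendreChart U H Ξ) {z : V × V} (hz : z ∈ slitDomain U H E)
    (η : V →L[ℝ] ℝ) :
    η z.2 - (chartScale H Ξ E z)⁻¹ * (H (z.1, η) - E) ≤ chartFinsler H Ξ E z := by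
  obtain ⟨hμ, hμE⟩ := hC.chartScale_spec hz
  have h1 := hC.add_apply_le hz.1 (chartScale H Ξ E z • z.2) η
  change H (z.1, chartMomentum H Ξ E z) + (η - chartMomentum H Ξ E z) _ ≤ _ at h1
  rw [hμE] at h1
  simp only [sub_apply, map_smul, smul_eq_mul] at h1
  rw [chartFinsler, sub_le_iff_le_add, ← sub_le_iff_le_add', inv_mul_eq_div, le_div_iff₀ hμ]
  linarith

/-- By the envelope theorem the Finsler function is differentiable, since the maximizing momentum
and the Lagrange multiplier depend continuously on the point. -/
theorem hasFDerivAt_chartFinsler (hC : IsLegendreChart U H Ξ) {z : V × V}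
    (hz : z ∈ slitDomain U H E) :
    HasFDerivAt (chartFinsler H Ξ E)
      ((chartMomentum H Ξ E z).comp (ContinuousLinearMap.snd ℝ V V) -
        (chartScale H Ξ E z)⁻¹ • ((fderiv ℝ H (z.1, chartMomentum H Ξ E z)).comp
          (ContinuousLinearMap.inl ℝ V (V →L[ℝ] ℝ))).comp (ContinuousLinearMap.fst ℝ V V)) z := by
  have hmem : ∀ᶠ w in 𝓝 z, w ∈ slitDomain U H E := (hC.isOpen_slitDomain E).mem_nhds hz
  have hP := hC.continuousAt_chartMomentum hz
  have hμ := hC.continuousAt_chartScale hz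
  have hμ0 := (hC.chartScale_spec hz).1
  have hEz := (hC.chartScale_spec hz).2
  set P := chartMomentum H Ξ E
  set μ := chartScale H Ξ E
  set H' := fderiv ℝ H (z.1, P z)
  have hstrict : HasStrictFDerivAt H H' (z.1, P z) :=
    (hC.contDiffAt (z := (z.1, P z)) hz.1).hasStrictFDerivAt (by norm_num)
  -- the increment of `H` in the base direction, at a fixed but varying momentum
  have hbase : ∀ p : V × V → V →L[ℝ] ℝ, ContinuousAt p z → p z = P z →
      (fun w => H (w.1, p w) - H (z.1, p w) - H' (w.1 - z.1, 0)) =o[𝓝 z] fun w => w - z := by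
    intro p hp hpz
    have ht : Filter.Tendsto (fun w : V × V => ((w.1, p w), (z.1, p w))) (𝓝 z)
        (𝓝 ((z.1, P z), (z.1, P z))) := by
      rw [← hpz]
      exact (continuousAt_fst.prodMk hp).prodMk (continuousAt_const.prodMk hp)
    have h1 := hstrict.isLittleO.comp_tendsto ht
    simp only [Function.comp_def, Prod.mk_sub_mk, sub_self] at h1
    refine h1.trans_isBigO (Asymptotics.IsBigO.of_bound 1 (Filter.Eventually.of_forall fun w => ?_))
    rw [one_mul, Prod.norm_mk, norm_zero, max_eq_left (norm_nonneg _)]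
    exact norm_fst_le (w - z)
  -- the maximality of `P z` and of `P w` bounds the remainder of the linear approximation at `w`
  -- by `A w` from above and by `B w` from below
  set A : V × V → ℝ := fun w => (P w - P z) (w.2 - z.2) -
    (μ z)⁻¹ * (H (w.1, P w) - H (z.1, P w) - H' (w.1 - z.1, 0))
  set B : V × V → ℝ := fun w => -((μ w)⁻¹ * (H (w.1, P z) - H (z.1, P z) - H' (w.1 - z.1, 0)) +
    ((μ w)⁻¹ - (μ z)⁻¹) * H' (w.1 - z.1, 0))
  have hA : A =o[𝓝 z] fun w => w - z := by
    refine Asymptotics.IsLittleO.sub ?_ ((hbase P hP rfl).const_mul_left _)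
    have h1 : (fun w => P w - P z) =o[𝓝 z] fun _ => (1 : ℝ) :=
      (Asymptotics.isLittleO_one_iff ℝ).2 (by
        simpa using hP.tendsto.sub (tendsto_const_nhds (x := P z)))
    have h2 : (fun w => ‖P w - P z‖ * ‖w - z‖) =o[𝓝 z] fun w => (1 : ℝ) * ‖w - z‖ :=
      h1.norm_left.mul_isBigO (Asymptotics.isBigO_refl _ _)
    simp only [one_mul] at h2
    refine Asymptotics.IsBigO.trans_isLittleO
      (Asymptotics.IsBigO.of_bound 1 (Filter.Eventually.of_forall fun w => ?_)) h2.of_norm_right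
    rw [one_mul, norm_mul, norm_norm, norm_norm]
    exact ((P w - P z).le_opNorm _).trans
      (mul_le_mul_of_nonneg_left (norm_snd_le (w - z)) (norm_nonneg _))
  have hμinv : Filter.Tendsto (fun w => (μ w)⁻¹) (𝓝 z) (𝓝 (μ z)⁻¹) := hμ.tendsto.inv₀ hμ0.ne'
  have hB : B =o[𝓝 z] fun w => w - z := by
    refine (Asymptotics.IsLittleO.add ?_ ?_).neg_left
    · have h1 := (hμinv.isBigO_one ℝ).mul_isLittleO
        (hbase (fun _ => P z) continuousAt_const rfl).norm_right
      simp only [one_mul] at h1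
      exact h1.of_norm_right
    · have h1 : (fun w => (μ w)⁻¹ - (μ z)⁻¹) =o[𝓝 z] fun _ => (1 : ℝ) :=
        (Asymptotics.isLittleO_one_iff ℝ).2 (by
          simpa using hμinv.sub (tendsto_const_nhds (x := (μ z)⁻¹)))
      have h2 : (fun w : V × V => H' (w.1 - z.1, 0)) =O[𝓝 z] fun w => ‖w - z‖ := by
        refine Asymptotics.IsBigO.of_bound ‖H'‖ (Filter.Eventually.of_forall fun w => ?_)
        refine (H'.le_opNorm _).trans (mul_le_mul_of_nonneg_left ?_ (norm_nonneg _))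
        rw [Prod.norm_mk, norm_zero, max_eq_left (norm_nonneg _), norm_norm]
        exact norm_fst_le (w - z)
      have h3 := h1.mul_isBigO h2
      simp only [one_mul] at h3
      exact h3.of_norm_right
  refine HasFDerivAt.of_isLittleO (Asymptotics.IsBigO.trans_isLittleO
    (Asymptotics.IsBigO.of_bound 1 ?_) (hA.norm_left.add hB.norm_left))
  filter_upwards [hmem] with w hw
  have hEw : H (w.1, P w) = E := (hC.chartScale_spec hw).2
  have h1 : P w z.2 - (μ z)⁻¹ * (H (z.1, P w) - E) ≤ P z z.2 := hC.le_chartFinsler hz (P w)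
  have h2 : P z w.2 - (μ w)⁻¹ * (H (w.1, P z) - E) ≤ P w w.2 := hC.le_chartFinsler hw (P z)
  have h3 : ((P z).comp (ContinuousLinearMap.snd ℝ V V) -
        (μ z)⁻¹ • (H'.comp (ContinuousLinearMap.inl ℝ V (V →L[ℝ] ℝ))).comp
          (ContinuousLinearMap.fst ℝ V V)) (w - z) =
      P z w.2 - P z z.2 - (μ z)⁻¹ * H' (w.1 - z.1, 0) := by simp
  have h4 : A w = P w w.2 - P w z.2 - (P z w.2 - P z z.2) -
      (μ z)⁻¹ * (E - H (z.1, P w) - H' (w.1 - z.1, 0)) := by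
    simp only [A, sub_apply, map_sub, hEw]
    ring
  have h5 : B w = -((μ w)⁻¹ * (H (w.1, P z) - E - H' (w.1 - z.1, 0)) +
    ((μ w)⁻¹ - (μ z)⁻¹) * H' (w.1 - z.1, 0)) := by simp only [B, hEz]
  rw [h3, one_mul]
  change ‖P w w.2 - P z z.2 - _‖ ≤ _
  simp only [Real.norm_eq_abs]
  rw [abs_of_nonneg (add_nonneg (abs_nonneg (A w)) (abs_nonneg (B w)))]
  have h6 := le_abs_self (A w)
  have h7 := neg_abs_le (B w)
  have h8 := abs_nonneg (A w)
  have h9 := abs_nonneg (B w)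
  rw [abs_le]
  constructor <;> nlinarith

theorem contDiffOn_chartFinsler (hC : IsLegendreChart U H Ξ) (E : ℝ) :
    ContDiffOn ℝ 1 (chartFinsler H Ξ E) (slitDomain U H E) := by
  rw [show (1 : WithTop ℕ∞) = 0 + 1 by norm_num,
    contDiffOn_succ_iff_fderiv_of_isOpen (hC.isOpen_slitDomain E)]
  refine ⟨fun z hz => (hC.hasFDerivAt_chartFinsler hz).differentiableAt.differentiableWithinAt,
    by simp, ?_⟩
  rw [contDiffOn_zero]
  refine ContinuousOn.congr ?_ fun z hz => (hC.hasFDerivAt_chartFinsler hz).fderiv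
  intro z hz
  have hP := hC.continuousAt_chartMomentum hz
  have h1 : ContinuousAt (fderiv ℝ H) (z.1, chartMomentum H Ξ E z) :=
    ((hC.contDiffAt (z := (z.1, chartMomentum H Ξ E z)) hz.1).fderiv_right (m := 1)
      (by norm_num)).continuousAt
  have h2 : ContinuousAt (fun w => fderiv ℝ H (w.1, chartMomentum H Ξ E w)) z :=
    ContinuousAt.comp (f := fun w : V × V => (w.1, chartMomentum H Ξ E w)) h1
      (continuousAt_fst.prodMk hP)
  have h3 := (hC.continuousAt_chartScale hz).inv₀ (hC.chartScale_spec hz).1.ne'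
  exact ((hP.clm_comp continuousAt_const).sub
    (h3.smul ((h2.clm_comp continuousAt_const).clm_comp continuousAt_const))).continuousWithinAt

theorem hasFDerivAt_chartFinsler_of_energy (hC : IsLegendreChart U H Ξ) {z : V × V}
    (hz : z ∈ slitDomain U H E) (hE : H (z.1, Ξ z) = E) :
    HasFDerivAt (chartFinsler H Ξ E) ((Ξ z).comp (ContinuousLinearMap.snd ℝ V V) -
        ((fderiv ℝ H (z.1, Ξ z)).comp
          (ContinuousLinearMap.inl ℝ V (V →L[ℝ] ℝ))).comp (ContinuousLinearMap.fst ℝ V V)) z := by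
  have h1 : chartScale H Ξ E z = 1 := hC.chartScale_eq hz one_pos (by rwa [one_smul])
  have h2 := hC.hasFDerivAt_chartFinsler hz
  rwa [chartMomentum, h1, one_smul, inv_one, one_smul] at h2

end IsLegendreChart

end Chart

/-! ### Differentiation under the integral sign -/

section Integral

variable {a b δ : ℝ} {F : ℝ × ℝ → ℝ}

theorem uniqueDiffOn_variationDomain (hab : a < b) (δ : ℝ) :
    UniqueDiffOn ℝ (Icc a b ×ˢ Ioo (-δ) δ) :=
  (uniqueDiffOn_Icc hab).prod isOpen_Ioo.uniqueDiffOn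

theorem hasDerivAt_snd_of_hasFDerivWithinAt {G : Type*} [NormedAddCommGroup G] [NormedSpace ℝ G]
    {F : ℝ × ℝ → G} {F' : ℝ × ℝ →L[ℝ] G} {t u : ℝ} (ht : t ∈ Icc a b) (hu : u ∈ Ioo (-δ) δ)
    (hF : HasFDerivWithinAt F F' (Icc a b ×ˢ Ioo (-δ) δ) (t, u)) :
    HasDerivAt (fun u => F (t, u)) (F' (0, 1)) u := by
  have h1 : HasDerivWithinAt (fun u : ℝ => (t, u)) (0, 1) (Ioo (-δ) δ) u :=
    ((hasDerivAt_const u t).prodMk (hasDerivAt_id u)).hasDerivWithinAt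
  exact (hF.comp_hasDerivWithinAt (f := fun u : ℝ => (t, u)) u h1
    fun _ hs => ⟨ht, hs⟩).hasDerivAt (isOpen_Ioo.mem_nhds hu)

theorem hasDerivWithinAt_fst_of_hasFDerivWithinAt {G : Type*} [NormedAddCommGroup G]
    [NormedSpace ℝ G]
    {F : ℝ × ℝ → G} {F' : ℝ × ℝ →L[ℝ] G} {t u : ℝ} (hu : u ∈ Ioo (-δ) δ)
    (hF : HasFDerivWithinAt F F' (Icc a b ×ˢ Ioo (-δ) δ) (t, u)) :
    HasDerivWithinAt (fun t => F (t, u)) (F' (1, 0)) (Icc a b) t := by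
  have h1 : HasDerivWithinAt (fun t : ℝ => (t, u)) (1, 0) (Icc a b) t :=
    ((hasDerivAt_id t).prodMk (hasDerivAt_const t u)).hasDerivWithinAt
  exact hF.comp_hasDerivWithinAt (f := fun t : ℝ => (t, u)) t h1 fun _ hs => ⟨hs, hu⟩

theorem continuousOn_deriv_snd (hab : a < b) (hδ : 0 < δ)
    (hF : ContDiffOn ℝ 1 F (Icc a b ×ˢ Ioo (-δ) δ)) :
    ContinuousOn (fun t => deriv (fun u => F (t, u)) 0) (Icc a b) := by
  have hS := uniqueDiffOn_variationDomain hab δ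
  have h0 : (0 : ℝ) ∈ Ioo (-δ) δ := ⟨neg_lt_zero.2 hδ, hδ⟩
  have h1 : ContinuousOn (fun t => fderivWithin ℝ F (Icc a b ×ˢ Ioo (-δ) δ) (t, 0) (0, 1))
      (Icc a b) :=
    ((hF.continuousOn_fderivWithin hS le_rfl).comp
      (f := fun t : ℝ => (t, (0 : ℝ))) (by fun_prop) fun t ht => ⟨ht, h0⟩).clm_apply
        continuousOn_const
  refine h1.congr fun t ht => ?_
  exact (hasDerivAt_snd_of_hasFDerivWithinAt ht h0
    ((hF.differentiableOn one_ne_zero) (t, 0) ⟨ht, h0⟩).hasFDerivWithinAt).deriv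

theorem hasDerivAt_integral_of_contDiffOn (hab : a < b) (hδ : 0 < δ)
    (hF : ContDiffOn ℝ 1 F (Icc a b ×ˢ Ioo (-δ) δ)) :
    HasDerivAt (fun u => ∫ t in a..b, F (t, u))
      (∫ t in a..b, deriv (fun u => F (t, u)) 0) 0 := by
  have hS := uniqueDiffOn_variationDomain hab δ
  set S := Icc a b ×ˢ Ioo (-δ) δ
  have hG : ContinuousOn (fun z => fderivWithin ℝ F S z (0, 1)) S :=
    (hF.continuousOn_fderivWithin hS le_rfl).clm_apply continuousOn_const
  have hsub : Icc a b ×ˢ Icc (-(δ / 2)) (δ / 2) ⊆ S :=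
    prod_mono_right fun u hu => ⟨by linarith [hu.1], by linarith [hu.2]⟩
  obtain ⟨C, hC⟩ := (isCompact_Icc.prod isCompact_Icc).exists_bound_of_continuousOn (hG.mono hsub)
  have hd : ∀ t ∈ Icc a b, ∀ u ∈ Ioo (-δ) δ,
      HasDerivAt (fun u => F (t, u)) (fderivWithin ℝ F S (t, u) (0, 1)) u := fun t ht u hu =>
    hasDerivAt_snd_of_hasFDerivWithinAt ht hu
      ((hF.differentiableOn one_ne_zero) (t, u) ⟨ht, hu⟩).hasFDerivWithinAt
  have hcont : ∀ u ∈ Ioo (-δ) δ, ContinuousOn (fun t => F (t, u)) (Icc a b) := fun u hu =>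
    hF.continuousOn.comp (f := fun t : ℝ => (t, u)) (by fun_prop) fun t ht => ⟨ht, hu⟩
  have hmeas : ∀ u ∈ Ioo (-δ) δ, IntervalIntegrable (fun t => F (t, u)) MeasureTheory.volume a b :=
    fun u hu => ContinuousOn.intervalIntegrable (by rw [uIcc_of_le hab.le]; exact hcont u hu)
  have hnhds : Ioo (-(δ / 2)) (δ / 2) ∈ 𝓝 (0 : ℝ) := Ioo_mem_nhds (by linarith) (by linarith)
  have hIoc : ∀ {t}, t ∈ uIoc a b → t ∈ Icc a b := fun {t} ht => by
    rw [uIoc_of_le hab.le] at ht; exact Ioc_subset_Icc_self ht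
  have hlt : ∀ {u}, u ∈ Ioo (-(δ / 2)) (δ / 2) → u ∈ Ioo (-δ) δ := fun {u} hu =>
    ⟨by linarith [hu.1], by linarith [hu.2]⟩
  have h0 : (0 : ℝ) ∈ Ioo (-δ) δ := ⟨neg_lt_zero.2 hδ, hδ⟩
  have key := (intervalIntegral.hasDerivAt_integral_of_dominated_loc_of_deriv_le
    (F := fun u t => F (t, u)) (F' := fun u t => deriv (fun u => F (t, u)) u)
    (bound := fun _ => C) (μ := MeasureTheory.volume) hnhds
    (by
      filter_upwards [hnhds] with u hu
      exact (hmeas u (hlt hu)).aestronglyMeasurable_restrict_uIoc)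
    (hmeas 0 h0)
    (ContinuousOn.intervalIntegrable (by
      rw [uIcc_of_le hab.le]
      exact continuousOn_deriv_snd hab hδ hF)).aestronglyMeasurable_restrict_uIoc
    (Filter.Eventually.of_forall fun t ht u hu => by
      rw [(hd t (hIoc ht) u (hlt hu)).deriv]
      exact hC (t, u) ⟨hIoc ht, Ioo_subset_Icc_self hu⟩)
    intervalIntegrable_const
    (Filter.Eventually.of_forall fun t ht u hu => by
      have := hd t (hIoc ht) u (hlt hu)
      rwa [← this.deriv] at this)).2
  exact key

end Integral

/-! ### The first variation and cotangent lifts in a chart -/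

section Chart

variable {V : Type*} [NormedAddCommGroup V] [NormedSpace ℝ V]

/-- The first variation formula in a chart, for a variation `q` of a curve of energy `E` with
momentum `p` and variational field `w`: the integrand is `d/dt (p w) - (p' + ∂H/∂q) w`. -/
theorem IsLegendreChart.first_variation {U : Set V} {H : V × (V →L[ℝ] ℝ) → ℝ}
    {Ξ : V × V → V →L[ℝ] ℝ} {E : ℝ} (hC : IsLegendreChart U H Ξ) {a b δ t : ℝ} (hab : a < b)
    (hδ : 0 < δ) (ht : t ∈ Icc a b) {q : ℝ × ℝ → V} {Dq : ℝ × ℝ → ℝ × ℝ →L[ℝ] V}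
    (hDq : Dq = fderivWithin ℝ q (Icc a b ×ˢ Ioo (-δ) δ))
    (hq : ContDiffWithinAt ℝ 2 q (Icc a b ×ˢ Ioo (-δ) δ) (t, 0))
    (hslit : (q (t, 0), Dq (t, 0) (1, 0)) ∈ slitDomain U H E)
    (hE : H (q (t, 0), Ξ (q (t, 0), Dq (t, 0) (1, 0))) = E) {p' : V →L[ℝ] ℝ}
    (hp : HasDerivWithinAt (fun s => Ξ (q (s, 0), Dq (s, 0) (1, 0))) p' (Icc a b) t) :
    ∃ g : ℝ, HasDerivWithinAt
        (fun s => Ξ (q (s, 0), Dq (s, 0) (1, 0)) (Dq (s, 0) (0, 1))) g (Icc a b) t ∧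
      HasDerivAt (fun u => chartFinsler H Ξ E (q (t, u), Dq (t, u) (1, 0)))
        (g - (p' (Dq (t, 0) (0, 1)) +
          fderiv ℝ H (q (t, 0), Ξ (q (t, 0), Dq (t, 0) (1, 0))) (Dq (t, 0) (0, 1), 0))) 0 := by
  have h0 : (0 : ℝ) ∈ Ioo (-δ) δ := ⟨neg_lt_zero.2 hδ, hδ⟩
  have hS := uniqueDiffOn_variationDomain hab δ
  have hz : (t, (0 : ℝ)) ∈ Icc a b ×ˢ Ioo (-δ) δ := ⟨ht, h0⟩
  have hsymm : IsSymmSndFDerivWithinAt ℝ q (Icc a b ×ˢ Ioo (-δ) δ) (t, 0) := by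
    refine hq.isSymmSndFDerivWithinAt (by simp) hS ?_ hz
    rw [interior_prod_eq, interior_Icc, interior_Ioo, closure_prod_eq, closure_Ioo hab.ne]
    exact ⟨ht, subset_closure h0⟩
  have hq1 : HasFDerivWithinAt q (Dq (t, 0)) (Icc a b ×ˢ Ioo (-δ) δ) (t, 0) := by
    rw [hDq]; exact (hq.differentiableWithinAt (by norm_num)).hasFDerivWithinAt
  have hD1 : HasFDerivWithinAt Dq (fderivWithin ℝ Dq (Icc a b ×ˢ Ioo (-δ) δ) (t, 0))
      (Icc a b ×ˢ Ioo (-δ) δ) (t, 0) := by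
    refine DifferentiableWithinAt.hasFDerivWithinAt ?_
    rw [hDq]
    exact (hq.fderivWithin_right (m := 1) hS (by norm_num) hz).differentiableWithinAt one_ne_zero
  set D2 := fderivWithin ℝ Dq (Icc a b ×ˢ Ioo (-δ) δ) (t, 0) with hD2
  have hcomm : D2 (1, 0) (0, 1) = D2 (0, 1) (1, 0) := by
    rw [hD2, hDq]; exact hsymm (1, 0) (0, 1)
  have hDt := hasDerivWithinAt_fst_of_hasFDerivWithinAt h0 hD1
  have hDu := hasDerivAt_snd_of_hasFDerivWithinAt ht h0 hD1
  have hqu := hasDerivAt_snd_of_hasFDerivWithinAt ht h0 hq1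
  have hw : HasDerivWithinAt (fun s => Dq (s, 0) (0, 1)) (D2 (1, 0) (0, 1)) (Icc a b) t := by
    simpa using hDt.clm_apply (hasDerivWithinAt_const t (Icc a b) ((0 : ℝ), (1 : ℝ)))
  have hvu : HasDerivAt (fun u => Dq (t, u) (1, 0)) (D2 (0, 1) (1, 0)) 0 := by
    simpa using hDu.clm_apply (hasDerivAt_const 0 ((1 : ℝ), (0 : ℝ)))
  refine ⟨_, hp.clm_apply hw, ?_⟩
  have hL := hC.hasFDerivAt_chartFinsler_of_energy hslit hE
  have h2 := HasFDerivAt.comp_hasDerivAt (f := fun u => (q (t, u), Dq (t, u) (1, 0))) (0 : ℝ) hL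
    (hqu.prodMk hvu)
  refine h2.congr_deriv ?_
  simp [hcomm]

/-- The cotangent lift `T` of a change of coordinates `τ` maps Hamiltonian vectors to Hamiltonian
vectors: it preserves `dq ∧ dp`, because the second derivative of `τ` is symmetric. -/
theorem hamiltonian_vector_of_cotangent_lift {H₀ H₁ : V × (V →L[ℝ] ℝ) → ℝ}
    {T : V × (V →L[ℝ] ℝ) → V × (V →L[ℝ] ℝ)} {τ : V → V} {z v : V × (V →L[ℝ] ℝ)}
    {T' : V × (V →L[ℝ] ℝ) →L[ℝ] V × (V →L[ℝ] ℝ)} (hT : HasFDerivAt T T' z)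
    (hfst : ∀ᶠ w in 𝓝 z, (T w).1 = τ w.1)
    (hsnd : ∀ᶠ w in 𝓝 z, (T w).2.comp (fderiv ℝ τ w.1) = w.2)
    (hτ : ContDiffAt ℝ 2 τ z.1) (hsurj : Function.Surjective (fderiv ℝ τ z.1))
    (hH : H₁ =ᶠ[𝓝 z] H₀ ∘ T) (hH₀ : DifferentiableAt ℝ H₀ (T z))
    (hv : ∀ w : V × (V →L[ℝ] ℝ), w.2 v.1 - v.2 w.1 = fderiv ℝ H₁ z w)
    (w : V × (V →L[ℝ] ℝ)) : w.2 (T' v).1 - (T' v).2 w.1 = fderiv ℝ H₀ (T z) w := by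
  set D2 := fderiv ℝ (fderiv ℝ τ) z.1
  have hD2 : HasFDerivAt (fderiv ℝ τ) D2 z.1 :=
    ((hτ.fderiv_right (m := 1) (by norm_num)).differentiableAt one_ne_zero).hasFDerivAt
  have hsymm : ∀ x y, D2 x y = D2 y x := fun x y => hτ.isSymmSndFDerivAt (by simp) x y
  have h1 : ∀ u, (T' u).1 = fderiv ℝ τ z.1 u.1 := by
    have hA : HasFDerivAt (fun w => (T w).1) ((ContinuousLinearMap.fst ℝ _ _).comp T') z :=
      hasFDerivAt_fst.comp z hT
    have hB : HasFDerivAt (fun w : V × (V →L[ℝ] ℝ) => τ w.1)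
        ((fderiv ℝ τ z.1).comp (ContinuousLinearMap.fst ℝ _ _)) z :=
      (hτ.differentiableAt (by norm_num)).hasFDerivAt.comp z hasFDerivAt_fst
    intro u
    exact DFunLike.congr_fun (hA.unique (hB.congr_of_eventuallyEq hfst)) u
  have h2 : ∀ u y, (T' u).2 (fderiv ℝ τ z.1 y) + (T z).2 (D2 u.1 y) = u.2 y := by
    have hA : HasFDerivAt (fun w => (T w).2) ((ContinuousLinearMap.snd ℝ _ _).comp T') z :=
      hasFDerivAt_snd.comp z hT
    have hB : HasFDerivAt (fun w : V × (V →L[ℝ] ℝ) => fderiv ℝ τ w.1)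
        (D2.comp (ContinuousLinearMap.fst ℝ _ _)) z := hD2.comp z hasFDerivAt_fst
    have hAB := (hA.clm_comp hB).unique
      (hasFDerivAt_snd.congr_of_eventuallyEq (f₁ := fun w => (T w).2.comp (fderiv ℝ τ w.1)) hsnd)
    intro u y
    have := DFunLike.congr_fun (DFunLike.congr_fun hAB u) y
    simp at this
    linarith
  have h3 : ∀ u, fderiv ℝ H₁ z u = fderiv ℝ H₀ (T z) (T' u) := by
    intro u
    rw [hH.fderiv_eq]
    exact DFunLike.congr_fun (hH₀.hasFDerivAt.comp z hT).fderiv u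
  have hTsurj : ∃ u, T' u = w := by
    obtain ⟨x, hx⟩ := hsurj w.1
    refine ⟨(x, w.2.comp (fderiv ℝ τ z.1) + (T z).2.comp (D2 x)), Prod.ext ((h1 _).trans hx) ?_⟩
    ext y
    obtain ⟨y, rfl⟩ := hsurj y
    have := h2 (x, w.2.comp (fderiv ℝ τ z.1) + (T z).2.comp (D2 x)) y
    simp at this
    exact this
  obtain ⟨u, rfl⟩ := hTsurj
  have h4 := h2 u v.1
  have h5 := h2 v u.1
  rw [hsymm v.1 u.1] at h5
  rw [← h3, ← hv, h1, h1]
  linarith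

end Chart

/-! ### Charts of the tangent and cotangent bundles -/

section Charts

variable {d : ℕ} {M : Type*} [TopologicalSpace M] [ChartedSpace (Model d) M]

/-- The differential at `x` of the preferred chart at `x₀`, with `T_x M` identified with `ℝ^d`. -/
noncomputable def chartDeriv (x₀ x : M) : Model d →L[ℝ] Model d :=
  mfderiv (𝓡 d) 𝓘(ℝ, Model d) (extChartAt (𝓡 d) x₀) x

/-- The differential of the inverse of the preferred chart at `x₀`, at the image of `x`. -/
noncomputable def chartDerivSymm (x₀ x : M) : Model d →L[ℝ] Model d :=
  mfderivWithin 𝓘(ℝ, Model d) (𝓡 d) (extChartAt (𝓡 d) x₀).symm (range (𝓡 d))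
    (extChartAt (𝓡 d) x₀ x)

variable [IsManifold (𝓡 d) ∞ M]

theorem isManifold_one : IsManifold (𝓡 d) 1 M :=
  IsManifold.of_le (n := ∞) (by simp)

theorem chartDeriv_comp_symm {x₀ x : M} (hx : x ∈ (extChartAt (𝓡 d) x₀).source) :
    (chartDeriv x₀ x).comp (chartDerivSymm x₀ x) = ContinuousLinearMap.id ℝ (Model d) :=
  haveI := isManifold_one (d := d) (M := M)
  mfderiv_extChartAt_comp_mfderivWithin_extChartAt_symm' hx

theorem chartDerivSymm_comp {x₀ x : M} (hx : x ∈ (extChartAt (𝓡 d) x₀).source) :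
    (chartDerivSymm x₀ x).comp (chartDeriv x₀ x) = ContinuousLinearMap.id ℝ (Model d) :=
  haveI := isManifold_one (d := d) (M := M)
  mfderivWithin_extChartAt_symm_comp_mfderiv_extChartAt' hx

theorem chartDeriv_symm_apply {x₀ x : M} (hx : x ∈ (extChartAt (𝓡 d) x₀).source) (v : Model d) :
    chartDeriv x₀ x (chartDerivSymm x₀ x v) = v :=
  DFunLike.congr_fun (chartDeriv_comp_symm hx) v

theorem chartDerivSymm_chartDeriv_apply {x₀ x : M} (hx : x ∈ (extChartAt (𝓡 d) x₀).source)
    (v : Model d) : chartDerivSymm x₀ x (chartDeriv x₀ x v) = v :=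
  DFunLike.congr_fun (chartDerivSymm_comp hx) v

/-- The point `(x, p)` of `T*M`, with `T*_x M` identified with `(ℝ^d)*`. -/
def mkCotangent (x : M) (p : Model d →L[ℝ] ℝ) : CotangentBundle d M := ⟨x, p⟩

/-- The point `(x, v)` of `TM`, with `T_x M` identified with `ℝ^d`. -/
def mkTangent (x : M) (v : Model d) : TangentBundle (𝓡 d) M := ⟨x, v⟩

/-- The inverse fibre derivative `v ↦ ξ_h(x, v)`, with `T_x M` identified with `ℝ^d`. -/
noncomputable def modelInv (h : CotangentBundle d M → ℝ) (x : M) (v : Model d) :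
    Model d →L[ℝ] ℝ :=
  invFibreDeriv h x v

/-- The fibre derivative `ξ ↦ Dh_x(ξ)`, with `T_x M` identified with `ℝ^d`. -/
noncomputable def modelFibreDeriv (h : CotangentBundle d M → ℝ) (x : M) (p : Model d →L[ℝ] ℝ) :
    Model d :=
  fibreDerivAt h x p

/-- The preferred chart of `T*M` over the preferred chart of `M` at `x₀`. -/
noncomputable abbrev cotangentChart (x₀ : M) :
    PartialEquiv (CotangentBundle d M) (Model d × (Model d →L[ℝ] ℝ)) :=
  extChartAt (cotangentModel d) (⟨x₀, 0⟩ : CotangentBundle d M)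

theorem mem_cotangentChart_source {x₀ : M} {y : CotangentBundle d M} :
    y ∈ (cotangentChart x₀).source ↔ y.1 ∈ (extChartAt (𝓡 d) x₀).source := by
  rw [extChartAt_source, extChartAt_source, FiberBundle.chartedSpace_chartAt]
  simp only [mfld_simps]
  refine ⟨fun hy => hy.1.1, fun hy => ⟨⟨hy, mem_univ _⟩, ?_⟩⟩
  rwa [Trivialization.coe_fst']
  simpa [hom_trivializationAt_baseSet] using hy

theorem cotangentChart_apply {x₀ : M} {y : CotangentBundle d M}
    (hy : y.1 ∈ (extChartAt (𝓡 d) x₀).source) :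
    cotangentChart x₀ y = (extChartAt (𝓡 d) x₀ y.1,
      (show Model d →L[ℝ] ℝ from y.2).comp (chartDerivSymm x₀ y.1)) :=
  extChartAt_cotangentBundle ⟨x₀, 0⟩ y (by rwa [extChartAt_source] at hy)

theorem cotangentChart_mk {x₀ : M} {q : Model d} (hq : q ∈ (extChartAt (𝓡 d) x₀).target)
    (p : Model d →L[ℝ] ℝ) :
    cotangentChart x₀ (mkCotangent ((extChartAt (𝓡 d) x₀).symm q)
      (p.comp (chartDeriv x₀ ((extChartAt (𝓡 d) x₀).symm q)))) = (q, p) := by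
  have hx : (extChartAt (𝓡 d) x₀).symm q ∈ (extChartAt (𝓡 d) x₀).source :=
    (extChartAt (𝓡 d) x₀).map_target hq
  rw [cotangentChart_apply (y := mkCotangent ((extChartAt (𝓡 d) x₀).symm q) _) hx]
  refine Prod.ext ((extChartAt (𝓡 d) x₀).right_inv hq) ?_
  change (p.comp (chartDeriv _ _)).comp (chartDerivSymm x₀ ((extChartAt (𝓡 d) x₀).symm q)) = p
  rw [ContinuousLinearMap.comp_assoc, chartDeriv_comp_symm hx, ContinuousLinearMap.comp_id]

theorem mem_cotangentChart_target {x₀ : M} {q : Model d}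
    (hq : q ∈ (extChartAt (𝓡 d) x₀).target) (p : Model d →L[ℝ] ℝ) :
    (q, p) ∈ (cotangentChart x₀).target := by
  rw [← cotangentChart_mk hq p]
  exact (cotangentChart x₀).map_source
    (mem_cotangentChart_source.2 ((extChartAt (𝓡 d) x₀).map_target hq))

theorem cotangentChart_symm_apply {x₀ : M} {q : Model d}
    (hq : q ∈ (extChartAt (𝓡 d) x₀).target) (p : Model d →L[ℝ] ℝ) :
    (cotangentChart x₀).symm (q, p) = mkCotangent
      ((extChartAt (𝓡 d) x₀).symm q) (p.comp (chartDeriv x₀ ((extChartAt (𝓡 d) x₀).symm q))) := by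
  rw [← cotangentChart_mk hq p]
  exact (cotangentChart x₀).left_inv
    (mem_cotangentChart_source.2 ((extChartAt (𝓡 d) x₀).map_target hq))

/-- The preferred chart of `TM` over the preferred chart of `M` at `x₀`. -/
noncomputable abbrev tangentChart (x₀ : M) :
    PartialEquiv (TangentBundle (𝓡 d) M) (Model d × Model d) :=
  extChartAt (𝓡 d).tangent (⟨x₀, 0⟩ : TangentBundle (𝓡 d) M)

theorem mem_tangentChart_source {x₀ : M} {y : TangentBundle (𝓡 d) M} :
    y ∈ (tangentChart x₀).source ↔ y.1 ∈ (extChartAt (𝓡 d) x₀).source := by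
  rw [extChartAt_source, extChartAt_source]
  exact TangentBundle.mem_chart_source_iff _ _

theorem tangentChart_apply {x₀ : M} {y : TangentBundle (𝓡 d) M}
    (hy : y.1 ∈ (extChartAt (𝓡 d) x₀).source) :
    tangentChart x₀ y = (extChartAt (𝓡 d) x₀ y.1, chartDeriv x₀ y.1 y.2) := by
  have := isManifold_one (d := d) (M := M)
  rw [extChartAt_source] at hy
  have h1 := TangentBundle.continuousLinearMapAt_trivializationAt (I := 𝓡 d) hy
  refine Prod.ext rfl ((?_ : _ = _).trans (DFunLike.congr_fun h1 y.2))
  rw [Trivialization.continuousLinearMapAt_apply, Trivialization.coe_linearMapAt_of_mem _ hy]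
  rfl

theorem tangentChart_symm_apply {x₀ : M} {q : Model d}
    (hq : q ∈ (extChartAt (𝓡 d) x₀).target) (v : Model d) :
    (q, v) ∈ (tangentChart x₀).target ∧
    (tangentChart x₀).symm (q, v) = (mkTangent
      ((extChartAt (𝓡 d) x₀).symm q) (chartDerivSymm x₀ ((extChartAt (𝓡 d) x₀).symm q) v)) := by
  have hx : (extChartAt (𝓡 d) x₀).symm q ∈ (extChartAt (𝓡 d) x₀).source :=
    (extChartAt (𝓡 d) x₀).map_target hq
  have h1 : tangentChart x₀ (mkTangent
      ((extChartAt (𝓡 d) x₀).symm q)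
        (chartDerivSymm x₀ ((extChartAt (𝓡 d) x₀).symm q) v)) = (q, v) := by
    rw [tangentChart_apply (y := mkTangent ((extChartAt (𝓡 d) x₀).symm q) _) hx]
    exact Prod.ext ((extChartAt (𝓡 d) x₀).right_inv hq) (chartDeriv_symm_apply hx v)
  rw [← h1]
  exact ⟨(tangentChart x₀).map_source (mem_tangentChart_source.2 hx),
    (tangentChart x₀).left_inv (mem_tangentChart_source.2 hx)⟩

/-! ### The Hamilton function in a chart -/

/-- The Hamilton function in the canonical coordinates over the preferred chart at `x₀`. -/
noncomputable def chartHam (h : CotangentBundle d M → ℝ) (x₀ : M)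
    (z : Model d × (Model d →L[ℝ] ℝ)) : ℝ :=
  h ((cotangentChart x₀).symm z)

/-- The inverse Legendre transformation `ξ_h` in the coordinates of the preferred chart at `x₀`. -/
noncomputable def chartInv (h : CotangentBundle d M → ℝ) (x₀ : M) (z : Model d × Model d) :
    Model d →L[ℝ] ℝ :=
  (modelInv h ((extChartAt (𝓡 d) x₀).symm z.1)
    (chartDerivSymm x₀ ((extChartAt (𝓡 d) x₀).symm z.1) z.2)).comp
      (chartDerivSymm x₀ ((extChartAt (𝓡 d) x₀).symm z.1))

variable {h : CotangentBundle d M → ℝ}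

theorem chartHam_apply {x₀ : M} {q : Model d} (hq : q ∈ (extChartAt (𝓡 d) x₀).target)
    (p : Model d →L[ℝ] ℝ) :
    chartHam h x₀ (q, p) = h (mkCotangent
      ((extChartAt (𝓡 d) x₀).symm q) (p.comp (chartDeriv x₀ ((extChartAt (𝓡 d) x₀).symm q)))) := by
  rw [chartHam, cotangentChart_symm_apply hq]

theorem contDiffOn_chartHam (h_smooth : ContMDiff (cotangentModel d) 𝓘(ℝ, ℝ) ∞ h) (x₀ : M) :
    ContDiffOn ℝ ∞ (chartHam h x₀) ((extChartAt (𝓡 d) x₀).target ×ˢ univ) := by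
  have h1 : ContMDiffOn 𝓘(ℝ, Model d × (Model d →L[ℝ] ℝ)) 𝓘(ℝ, ℝ) ∞ (chartHam h x₀)
      (cotangentChart x₀).target :=
    h_smooth.comp_contMDiffOn (contMDiffOn_extChartAt_symm (I := cotangentModel d) (n := ∞) _)
  exact h1.contDiffOn.mono fun z hz => mem_cotangentChart_target hz.1 z.2

omit [IsManifold (𝓡 d) ∞ M] in
theorem apply_fibreDerivAt (x : M) (ξ η : CotangentSpace d x) :
    η (fibreDerivAt h x ξ) = fderiv ℝ (fun η : CotangentSpace d x => h ⟨x, η⟩) ξ η := by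
  have : FiniteDimensional ℝ (TangentSpace (𝓡 d) x) :=
    inferInstanceAs (FiniteDimensional ℝ (Model d))
  have : T2Space (TangentSpace (𝓡 d) x) := inferInstanceAs (T2Space (Model d))
  exact vectorOfBidual_spec (V := TangentSpace (𝓡 d) x) _ _

/-- The fibre derivative of `h` is `∂H/∂p` in the coordinates of the preferred chart at `x₀`. -/
theorem fderiv_chartHam_inr (h_smooth : ContMDiff (cotangentModel d) 𝓘(ℝ, ℝ) ∞ h) {x₀ : M}
    {q : Model d} (hq : q ∈ (extChartAt (𝓡 d) x₀).target) (p η : Model d →L[ℝ] ℝ) :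
    fderiv ℝ (chartHam h x₀) (q, p) (0, η) =
      η (chartDeriv x₀ ((extChartAt (𝓡 d) x₀).symm q) (modelFibreDeriv h
        ((extChartAt (𝓡 d) x₀).symm q)
          (p.comp (chartDeriv x₀ ((extChartAt (𝓡 d) x₀).symm q))))) := by
  have hx : (extChartAt (𝓡 d) x₀).symm q ∈ (extChartAt (𝓡 d) x₀).source :=
    (extChartAt (𝓡 d) x₀).map_target hq
  set x := (extChartAt (𝓡 d) x₀).symm q with hxq
  set e := chartDeriv (d := d) x₀ x
  set A := chartDerivSymm (d := d) x₀ x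
  have heA : e.comp A = ContinuousLinearMap.id ℝ (Model d) := chartDeriv_comp_symm hx
  have hAe : A.comp e = ContinuousLinearMap.id ℝ (Model d) := chartDerivSymm_comp hx
  have h1 : (fun η : Model d →L[ℝ] ℝ => h (mkCotangent x η)) =
      fun η => chartHam h x₀ (q, η.comp A) := by
    funext η
    rw [chartHam_apply hq, ContinuousLinearMap.comp_assoc, ← hxq, hAe, ContinuousLinearMap.comp_id]
  have hH : HasFDerivAt (chartHam h x₀) (fderiv ℝ (chartHam h x₀) (q, p))
      (q, (p.comp e).comp A) := by
    rw [ContinuousLinearMap.comp_assoc, heA, ContinuousLinearMap.comp_id]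
    exact (((contDiffOn_chartHam h_smooth x₀).contDiffAt
      (((isOpen_extChartAt_target x₀).prod isOpen_univ).mem_nhds
        ⟨hq, mem_univ _⟩)).differentiableAt (by simp)).hasFDerivAt
  have h2 : HasFDerivAt (fun η : Model d →L[ℝ] ℝ => (q, η.comp A))
      ((ContinuousLinearMap.inr ℝ (Model d) (Model d →L[ℝ] ℝ)).comp
        ((ContinuousLinearMap.compL ℝ (Model d) (Model d) ℝ).flip A)) (p.comp e) :=
    (hasFDerivAt_prodMk_right q _).comp (p.comp e)
      ((ContinuousLinearMap.compL ℝ (Model d) (Model d) ℝ).flip A).hasFDerivAt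
  have h3 := hH.comp (p.comp e) h2
  have h4 : fderiv ℝ (fun η : Model d →L[ℝ] ℝ => h (mkCotangent x η)) (p.comp e)
      (η.comp e) = fderiv ℝ (chartHam h x₀) (q, p) (0, η) := by
    rw [h1]
    refine (DFunLike.congr_fun h3.fderiv (η.comp e)).trans ?_
    change fderiv ℝ (chartHam h x₀) (q, p) (0, (η.comp e).comp A) = _
    rw [ContinuousLinearMap.comp_assoc, heA, ContinuousLinearMap.comp_id]
  rw [← h4]
  exact (apply_fibreDerivAt (d := d) (h := h) x (show Model d →L[ℝ] ℝ from p.comp e)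
    (show Model d →L[ℝ] ℝ from η.comp e)).symm

theorem modelFibreDeriv_modelInv (h_hyperregular : Hyperregular h) (x : M)
    (v : Model d) : modelFibreDeriv h x (modelInv h x v) = v := by
  have key : ∀ w : TangentSpace (𝓡 d) x, fibreDerivAt h x (invFibreDeriv h x w) = w := by
    intro w
    have := fibreDeriv_invFibreDeriv h_hyperregular x w
    simpa [fibreDeriv] using this
  exact key v

theorem chartInv_comp {x₀ : M} {q : Model d} (hq : q ∈ (extChartAt (𝓡 d) x₀).target)
    (v : Model d) : (chartInv h x₀ (q, v)).comp (chartDeriv x₀ ((extChartAt (𝓡 d) x₀).symm q)) =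
      modelInv h ((extChartAt (𝓡 d) x₀).symm q)
        (chartDerivSymm x₀ ((extChartAt (𝓡 d) x₀).symm q) v) := by
  have hx : (extChartAt (𝓡 d) x₀).symm q ∈ (extChartAt (𝓡 d) x₀).source :=
    (extChartAt (𝓡 d) x₀).map_target hq
  rw [chartInv, ContinuousLinearMap.comp_assoc, chartDerivSymm_comp hx]
  exact ContinuousLinearMap.comp_id _

theorem contDiffOn_chartInv (h_hyperregular : Hyperregular h) (x₀ : M) :
    ContDiffOn ℝ ∞ (chartInv h x₀) ((extChartAt (𝓡 d) x₀).target ×ˢ univ) := by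
  obtain ⟨Φ, hΦ⟩ := h_hyperregular
  have hΦsymm : ∀ (x : M) (v : Model d),
      Φ.symm (mkTangent x v) = mkCotangent x (modelInv h x v) := by
    intro x v
    have h1 : Φ (mkCotangent x (modelInv h x v)) = mkTangent x v :=
      (hΦ _).trans (fibreDeriv_invFibreDeriv ⟨Φ, hΦ⟩ x v)
    rw [← h1]
    exact Φ.symm_apply_apply _
  have h1 : ContMDiffOn 𝓘(ℝ, Model d × Model d) (cotangentModel d) ∞
      (Φ.symm ∘ (tangentChart x₀).symm) ((extChartAt (𝓡 d) x₀).target ×ˢ univ) :=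
    Φ.symm.contMDiff.comp_contMDiffOn
      ((contMDiffOn_extChartAt_symm (I := (𝓡 d).tangent) (n := ∞) _).mono
        fun z hz => (tangentChart_symm_apply hz.1 z.2).1)
  have h2 : ∀ z ∈ (extChartAt (𝓡 d) x₀).target ×ˢ (univ : Set (Model d)),
      (Φ.symm ∘ (tangentChart x₀).symm) z = mkCotangent ((extChartAt (𝓡 d) x₀).symm z.1)
        (modelInv h ((extChartAt (𝓡 d) x₀).symm z.1)
          (chartDerivSymm x₀ ((extChartAt (𝓡 d) x₀).symm z.1) z.2)) := by
    intro z hz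
    rw [Function.comp_apply, ← hΦsymm]
    exact congrArg Φ.symm (tangentChart_symm_apply hz.1 z.2).2
  have h3 : ContMDiffOn (cotangentModel d) 𝓘(ℝ, Model d × (Model d →L[ℝ] ℝ)) ∞
      (cotangentChart (d := d) x₀) (cotangentChart (d := d) x₀).source := by
    rw [extChartAt_source]
    exact contMDiffOn_extChartAt (I := cotangentModel d) (n := ∞)
  have h4 := h3.comp h1 fun z hz => by
    rw [mem_preimage, mem_cotangentChart_source, h2 z hz]
    exact (extChartAt (𝓡 d) x₀).map_target hz.1
  refine h4.contDiffOn.snd.congr fun z hz => ?_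
  rw [Function.comp_apply, h2 z hz, cotangentChart_apply (d := d)]
  · rfl
  · exact (extChartAt (𝓡 d) x₀).map_target hz.1

theorem isLegendreChart_chartHam (h_smooth : ContMDiff (cotangentModel d) 𝓘(ℝ, ℝ) ∞ h)
    (h_hyperregular : Hyperregular h)
    (h_even : ∀ (x : M) (ξ : CotangentSpace d x), h ⟨x, -ξ⟩ = h ⟨x, ξ⟩)
    (h_convex : ∀ x : M, StrictConvexOn ℝ univ (fun ξ : CotangentSpace d x => h ⟨x, ξ⟩))
    (x₀ : M) :
    IsLegendreChart (extChartAt (𝓡 d) x₀).target (chartHam h x₀) (chartInv h x₀) where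
  isOpen := isOpen_extChartAt_target x₀
  contDiffOn := (contDiffOn_chartHam h_smooth x₀).of_le (WithTop.coe_le_coe.2 le_top)
  strictConvexOn q hq := by
    refine ⟨convex_univ, fun p _ p' _ hne s t hs ht hst => ?_⟩
    have hx : (extChartAt (𝓡 d) x₀).symm q ∈ (extChartAt (𝓡 d) x₀).source :=
      (extChartAt (𝓡 d) x₀).map_target hq
    simp only [chartHam_apply hq]
    set e := chartDeriv (d := d) x₀ ((extChartAt (𝓡 d) x₀).symm q)
    have hne' : p.comp e ≠ p'.comp e := by
      intro heq
      refine hne ?_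
      have := congrArg (fun r : Model d →L[ℝ] ℝ =>
        r.comp (chartDerivSymm x₀ ((extChartAt (𝓡 d) x₀).symm q))) heq
      simpa only [ContinuousLinearMap.comp_assoc, e, chartDeriv_comp_symm hx,
        ContinuousLinearMap.comp_id] using this
    have := (h_convex ((extChartAt (𝓡 d) x₀).symm q)).2 (mem_univ (p.comp e))
      (mem_univ (p'.comp e)) hne' hs ht hst
    rw [ContinuousLinearMap.add_comp, ContinuousLinearMap.smul_comp, ContinuousLinearMap.smul_comp]
    exact this
  even q hq p := by
    rw [chartHam_apply hq, chartHam_apply hq, ContinuousLinearMap.neg_comp]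
    exact h_even _ _
  contDiffOn_inv := (contDiffOn_chartInv h_hyperregular x₀).of_le (WithTop.coe_le_coe.2 le_top)
  fderiv_inr q hq v η := by
    rw [fderiv_chartHam_inr h_smooth hq]
    rw [chartInv_comp hq, modelFibreDeriv_modelInv h_hyperregular,
      chartDeriv_symm_apply ((extChartAt (𝓡 d) x₀).map_target hq)]

end Charts

section Charts

variable {d : ℕ} {M : Type*} [TopologicalSpace M] [ChartedSpace (Model d) M]

/-! ### Energy and Finsler function in a chart -/

/-- The energy function, with `T_x M` identified with `ℝ^d`. -/
noncomputable def modelEnergy [IsManifold (𝓡 d) ∞ M] (h : CotangentBundle d M → ℝ) (x : M)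
    (v : Model d) : ℝ :=
  energy h x v

/-- The Finsler function, with `T_x M` identified with `ℝ^d`. -/
noncomputable def modelFinsler [IsManifold (𝓡 d) ∞ M] (h : CotangentBundle d M → ℝ) (E : ℝ) (x : M)
    (v : Model d) : ℝ :=
  finslerFunction h E x v

/-- The velocity of a curve, with `T_x M` identified with `ℝ^d`. -/
noncomputable def modelVelocity (a b : ℝ) (γ : ℝ → M) (t : ℝ) : Model d :=
  velocity a b γ t

/-- The differential of a map into `M`, with `T_x M` identified with `ℝ^d`. -/
noncomputable def modelDeriv {F : Type*} [NormedAddCommGroup F] [NormedSpace ℝ F] (f : F → M)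
    (s : Set F) (z : F) : F →L[ℝ] Model d :=
  mfderivWithin 𝓘(ℝ, F) (𝓡 d) f s z

variable [IsManifold (𝓡 d) ∞ M] {h : CotangentBundle d M → ℝ}

omit [IsManifold (𝓡 d) ∞ M] in
theorem chartInv_extChartAt {x₀ x : M} (hx : x ∈ (extChartAt (𝓡 d) x₀).source) (w : Model d) :
    chartInv h x₀ (extChartAt (𝓡 d) x₀ x, w) =
      (modelInv h x (chartDerivSymm x₀ x w)).comp (chartDerivSymm x₀ x) := by
  rw [chartInv, (extChartAt (𝓡 d) x₀).left_inv hx]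

theorem chartHam_extChartAt {x₀ x : M} (hx : x ∈ (extChartAt (𝓡 d) x₀).source)
    (p : Model d →L[ℝ] ℝ) :
    chartHam h x₀ (extChartAt (𝓡 d) x₀ x, p) = h (mkCotangent x (p.comp (chartDeriv x₀ x))) := by
  rw [chartHam_apply ((extChartAt (𝓡 d) x₀).map_source hx), (extChartAt (𝓡 d) x₀).left_inv hx]

theorem modelEnergy_eq {x₀ x : M} (hx : x ∈ (extChartAt (𝓡 d) x₀).source) (v : Model d) :
    modelEnergy h x v = chartHam h x₀ (extChartAt (𝓡 d) x₀ x,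
      chartInv h x₀ (extChartAt (𝓡 d) x₀ x, chartDeriv x₀ x v)) := by
  rw [chartInv_extChartAt hx, chartHam_extChartAt hx, ContinuousLinearMap.comp_assoc,
    chartDerivSymm_comp hx, ContinuousLinearMap.comp_id, chartDerivSymm_chartDeriv_apply hx]
  rfl

theorem modelFinsler_eq {x₀ x : M} (hx : x ∈ (extChartAt (𝓡 d) x₀).source) (E : ℝ) (v : Model d) :
    modelFinsler h E x v = chartFinsler (chartHam h x₀) (chartInv h x₀) E
      (extChartAt (𝓡 d) x₀ x, chartDeriv x₀ x v) := by
  have h1 : chartScale (chartHam h x₀) (chartInv h x₀) E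
      (extChartAt (𝓡 d) x₀ x, chartDeriv x₀ x v) = energyScale h E x v := by
    have : ∀ μ : ℝ, chartHam h x₀ (extChartAt (𝓡 d) x₀ x,
        chartInv h x₀ (extChartAt (𝓡 d) x₀ x, μ • chartDeriv x₀ x v)) =
          modelEnergy h x (μ • v) := by
      intro μ
      rw [modelEnergy_eq hx, map_smul]
    simp only [chartScale, this]
    rfl
  rw [chartFinsler, chartMomentum, h1, chartInv_extChartAt hx, ← map_smul,
    chartDerivSymm_chartDeriv_apply hx, ContinuousLinearMap.comp_apply,
    chartDerivSymm_chartDeriv_apply hx]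
  rfl

/-! ### Curves and maps in a chart -/

theorem hasFDerivWithinAt_extChartAt_comp {F : Type*} [NormedAddCommGroup F] [NormedSpace ℝ F]
    {f : F → M} {s : Set F} {z : F} {x₀ : M}
    (hf : MDifferentiableWithinAt 𝓘(ℝ, F) (𝓡 d) f s z)
    (hx : f z ∈ (extChartAt (𝓡 d) x₀).source) :
    HasFDerivWithinAt (fun w => extChartAt (𝓡 d) x₀ (f w))
      ((chartDeriv x₀ (f z)).comp (modelDeriv f s z)) s z := by
  have := isManifold_one (d := d) (M := M)
  rw [extChartAt_source] at hx
  have h1 : HasMFDerivAt (𝓡 d) 𝓘(ℝ, Model d) (extChartAt (𝓡 d) x₀) (f z) (chartDeriv x₀ (f z)) :=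
    (mdifferentiableAt_extChartAt hx).hasMFDerivAt
  have h2 := h1.comp_hasMFDerivWithinAt z hf.hasMFDerivWithinAt
  exact h2.hasFDerivWithinAt

theorem hasDerivWithinAt_extChartAt_comp {a b t : ℝ} {γ : ℝ → M} {x₀ : M}
    (hγ : MDifferentiableWithinAt 𝓘(ℝ, ℝ) (𝓡 d) γ (Icc a b) t)
    (hx : γ t ∈ (extChartAt (𝓡 d) x₀).source) :
    HasDerivWithinAt (fun s => extChartAt (𝓡 d) x₀ (γ s))
      (chartDeriv x₀ (γ t) (modelVelocity a b γ t)) (Icc a b) t :=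
  (hasFDerivWithinAt_extChartAt_comp hγ hx).hasDerivWithinAt

theorem contDiffWithinAt_extChartAt_comp {F : Type*} [NormedAddCommGroup F] [NormedSpace ℝ F]
    {f : F → M} {s : Set F} {z : F} {x₀ : M}
    (hf : ContMDiffWithinAt 𝓘(ℝ, F) (𝓡 d) 2 f s z)
    (hx : f z ∈ (extChartAt (𝓡 d) x₀).source) :
    ContDiffWithinAt ℝ 2 (fun w => extChartAt (𝓡 d) x₀ (f w)) s z := by
  rw [extChartAt_source] at hx
  have h1 : ContMDiffAt (𝓡 d) 𝓘(ℝ, Model d) 2 (extChartAt (𝓡 d) x₀) (f z) :=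
    (contMDiffAt_extChartAt' (n := ∞) hx).of_le (WithTop.coe_le_coe.2 le_top)
  exact (h1.comp_contMDiffWithinAt z hf).contDiffWithinAt

theorem contMDiffWithinAt_of_extChartAt_comp {F : Type*} [NormedAddCommGroup F] [NormedSpace ℝ F]
    {f : F → M} {s : Set F} {z : F} {x₀ : M} (hf : ContinuousWithinAt f s z)
    (hx : f z ∈ (extChartAt (𝓡 d) x₀).source)
    (h : ContDiffWithinAt ℝ 2 (fun w => extChartAt (𝓡 d) x₀ (f w)) s z) :
    ContMDiffWithinAt 𝓘(ℝ, F) (𝓡 d) 2 f s z := by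
  have : IsManifold (𝓡 d) 2 M := IsManifold.of_le (n := ∞) (WithTop.coe_le_coe.2 le_top)
  rw [contMDiffWithinAt_iff_target_of_mem_source (by rwa [extChartAt_source] at hx)]
  exact ⟨hf, h.contMDiffWithinAt⟩

/-! ### The length integrand of a variation -/

section Variation

variable {E a b δ : ℝ} {γ : ℝ → M} {c : ℝ × ℝ → M}

omit [IsManifold (𝓡 d) ∞ M] in
theorem eventually_mem_source {F : Type*} [TopologicalSpace F] {f : F → M} {s : Set F} {z : F}
    {x₀ : M} (hf : ContinuousWithinAt f s z) (hx : f z ∈ (extChartAt (𝓡 d) x₀).source) :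
    ∀ᶠ w in 𝓝[s] z, f w ∈ (extChartAt (𝓡 d) x₀).source :=
  hf ((isOpen_extChartAt_source x₀).mem_nhds hx)

/-- The velocity of the curve `c (·, u)` in a chart is a partial derivative of `c` there. -/
theorem chartDeriv_modelVelocity (hab : a < b)
    (hc : IsRegularVariation d (regularSet h E) a b γ δ c) {x₀ : M} {z : ℝ × ℝ}
    (hz : z ∈ Icc a b ×ˢ Ioo (-δ) δ) (hx : c z ∈ (extChartAt (𝓡 d) x₀).source) :
    chartDeriv x₀ (c z) (modelVelocity a b (fun s => c (s, z.2)) z.1) =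
      fderivWithin ℝ (fun w => extChartAt (𝓡 d) x₀ (c w)) (Icc a b ×ˢ Ioo (-δ) δ) z (1, 0) := by
  have h1 := hasDerivWithinAt_extChartAt_comp (a := a) (b := b) (t := z.1)
    (γ := fun s => c (s, z.2)) (x₀ := x₀)
    (((hc.regular z.2 hz.2).contMDiffOn z.1 hz.1).mdifferentiableWithinAt (by norm_num)) hx
  have h2 := hasDerivWithinAt_fst_of_hasFDerivWithinAt (t := z.1) (u := z.2) hz.2
    ((contDiffWithinAt_extChartAt_comp (hc.contMDiffOn z hz) hx).differentiableWithinAt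
      (by norm_num)).hasFDerivWithinAt
  exact (uniqueDiffOn_Icc hab z.1 hz.1).eq_deriv _ h1 h2

theorem mem_slitDomain {x₀ x : M} (hx : x ∈ (extChartAt (𝓡 d) x₀).source)
    (hxE : x ∈ regularSet h E) {v : Model d} (hv : v ≠ 0) :
    (extChartAt (𝓡 d) x₀ x, chartDeriv x₀ x v) ∈
      slitDomain (extChartAt (𝓡 d) x₀).target (chartHam h x₀) E := by
  refine ⟨(extChartAt (𝓡 d) x₀).map_source hx, ?_, fun h0 => hv ?_⟩
  · rw [chartHam_extChartAt hx, ContinuousLinearMap.zero_comp]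
    exact not_le.1 hxE
  · have := chartDerivSymm_chartDeriv_apply hx v
    rw [← this]
    exact (congrArg (chartDerivSymm x₀ x) h0).trans (map_zero _)

theorem modelFinsler_variation_eq (hab : a < b)
    (hc : IsRegularVariation d (regularSet h E) a b γ δ c) {x₀ : M} {z : ℝ × ℝ}
    (hz : z ∈ Icc a b ×ˢ Ioo (-δ) δ) (hx : c z ∈ (extChartAt (𝓡 d) x₀).source) :
    modelFinsler h E (c z) (modelVelocity a b (fun s => c (s, z.2)) z.1) =
      chartFinsler (chartHam h x₀) (chartInv h x₀) E (extChartAt (𝓡 d) x₀ (c z),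
        fderivWithin ℝ (fun w => extChartAt (𝓡 d) x₀ (c w)) (Icc a b ×ˢ Ioo (-δ) δ) z (1, 0)) := by
  rw [modelFinsler_eq hx, chartDeriv_modelVelocity hab hc hz hx]

theorem variation_mem_slitDomain (hab : a < b)
    (hc : IsRegularVariation d (regularSet h E) a b γ δ c) {x₀ : M} {z : ℝ × ℝ}
    (hz : z ∈ Icc a b ×ˢ Ioo (-δ) δ) (hx : c z ∈ (extChartAt (𝓡 d) x₀).source) :
    (extChartAt (𝓡 d) x₀ (c z),
        fderivWithin ℝ (fun w => extChartAt (𝓡 d) x₀ (c w)) (Icc a b ×ˢ Ioo (-δ) δ) z (1, 0)) ∈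
      slitDomain (extChartAt (𝓡 d) x₀).target (chartHam h x₀) E := by
  rw [← chartDeriv_modelVelocity hab hc hz hx]
  exact mem_slitDomain hx ((hc.regular z.2 hz.2).mapsTo z.1 hz.1)
    ((hc.regular z.2 hz.2).velocity_ne_zero z.1 hz.1)

/-- The length integrand of a regular variation is continuously differentiable. -/
theorem contDiffOn_modelFinsler_variation
    (hC : ∀ x₀ : M, IsLegendreChart (extChartAt (𝓡 d) x₀).target (chartHam h x₀) (chartInv h x₀))
    (hab : a < b) (hc : IsRegularVariation d (regularSet h E) a b γ δ c) :
    ContDiffOn ℝ 1 (fun z : ℝ × ℝ => modelFinsler h E (c z)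
      (modelVelocity a b (fun s => c (s, z.2)) z.1)) (Icc a b ×ˢ Ioo (-δ) δ) := by
  intro z hz
  have hx := mem_extChartAt_source (I := 𝓡 d) (c z)
  have hq := contDiffWithinAt_extChartAt_comp (hc.contMDiffOn z hz) hx
  have hslit := variation_mem_slitDomain hab hc hz hx
  have h1 : ContDiffAt ℝ 1 (chartFinsler (chartHam h (c z)) (chartInv h (c z)) E) _ :=
    ((hC (c z)).contDiffOn_chartFinsler E).contDiffAt
      (((hC (c z)).isOpen_slitDomain E).mem_nhds hslit)
  have h2 := (hq.fderivWithin_right (m := 1) (uniqueDiffOn_variationDomain hab δ)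
    (by norm_num) hz).clm_apply (contDiffWithinAt_const (c := ((1 : ℝ), (0 : ℝ))))
  have h3 := h1.comp_contDiffWithinAt z ((hq.of_le (by norm_num)).prodMk h2)
  refine h3.congr_of_eventuallyEq ?_ (modelFinsler_variation_eq hab hc hz hx)
  filter_upwards [eventually_mem_source (hc.contMDiffOn z hz).continuousWithinAt hx,
    self_mem_nhdsWithin] with w hw hwS using modelFinsler_variation_eq hab hc hwS hw

end Variation

end Charts

/-! ### Hamiltonian vectors and integral curves in charts -/

section HamiltonVector

variable {V : Type*} [NormedAddCommGroup V] [NormedSpace ℝ V] [FiniteDimensional ℝ V]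

theorem vectorOfBidual_eq {φ : (V →L[ℝ] ℝ) →L[ℝ] ℝ} {v : V}
    (hv : ∀ η : V →L[ℝ] ℝ, φ η = η v) : vectorOfBidual φ = v :=
  (SeparatingDual.eq_iff_forall_dual_eq (R := ℝ)).2 fun η => by rw [vectorOfBidual_spec, hv]

variable (V) in
/-- The isomorphism `V** ≅ V` as a linear map. -/
noncomputable def bidualLinearMap : ((V →L[ℝ] ℝ) →L[ℝ] ℝ) →ₗ[ℝ] V where
  toFun := vectorOfBidual
  map_add' φ ψ := vectorOfBidual_eq fun η => by simp [vectorOfBidual_spec]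
  map_smul' r φ := vectorOfBidual_eq fun η => by simp [vectorOfBidual_spec]

theorem continuous_bidualLinearMap : Continuous (bidualLinearMap V) := by
  refine AddMonoidHomClass.continuous_of_bound (bidualLinearMap V) 1 fun φ => ?_
  have h1 : NormedSpace.inclusionInDoubleDual ℝ V (bidualLinearMap V φ) = φ := by
    ext η
    exact vectorOfBidual_spec φ η
  rw [one_mul]
  conv_rhs => rw [← h1]
  exact ((NormedSpace.inclusionInDoubleDualLi ℝ (E := V)).norm_map _).ge

variable (V) in
/-- The isomorphism `V** ≅ V` as a continuous linear map. -/
noncomputable def bidualCLM : ((V →L[ℝ] ℝ) →L[ℝ] ℝ) →L[ℝ] V :=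
  ⟨bidualLinearMap V, continuous_bidualLinearMap⟩

variable (V) in
/-- The Hamiltonian vector `(∂H/∂p, -∂H/∂q)`, as a function of the differential `dH`. -/
noncomputable def hamiltonianVector :
    ((V × (V →L[ℝ] ℝ)) →L[ℝ] ℝ) →L[ℝ] V × (V →L[ℝ] ℝ) :=
  ((bidualCLM V).comp ((ContinuousLinearMap.compL ℝ (V →L[ℝ] ℝ) (V × (V →L[ℝ] ℝ)) ℝ).flip
    (ContinuousLinearMap.inr ℝ V (V →L[ℝ] ℝ)))).prod
      (-(ContinuousLinearMap.compL ℝ V (V × (V →L[ℝ] ℝ)) ℝ).flip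
        (ContinuousLinearMap.inl ℝ V (V →L[ℝ] ℝ)))

theorem hamiltonianVector_apply (φ : (V × (V →L[ℝ] ℝ)) →L[ℝ] ℝ) :
    hamiltonianVector V φ = (vectorOfBidual (φ.comp (ContinuousLinearMap.inr ℝ _ _)),
        -φ.comp (ContinuousLinearMap.inl ℝ _ _)) :=
  rfl

theorem hamiltonianVector_spec (φ : (V × (V →L[ℝ] ℝ)) →L[ℝ] ℝ)
    (w : V × (V →L[ℝ] ℝ)) :
    w.2 (hamiltonianVector V φ).1 - (hamiltonianVector V φ).2 w.1 = φ w := by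
  rw [hamiltonianVector_apply, vectorOfBidual_spec]
  simp [← map_add]

theorem eq_hamiltonianVector {φ : (V × (V →L[ℝ] ℝ)) →L[ℝ] ℝ}
    {v : V × (V →L[ℝ] ℝ)}
    (hv : ∀ w : V × (V →L[ℝ] ℝ), w.2 v.1 - v.2 w.1 = φ w) :
    v = hamiltonianVector V φ := by
  rw [hamiltonianVector_apply]
  refine Prod.ext (vectorOfBidual_eq fun η => ?_).symm ?_
  · simpa using (hv (0, η)).symm
  · ext y
    have := hv (y, 0)
    simp at this
    simp [← this]

end HamiltonVector

/-- A solution of a differential equation is once more differentiable than it is known to be. -/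
theorem contDiffWithinAt_succ_of_hasDerivWithinAt {F : Type*} [NormedAddCommGroup F]
    [NormedSpace ℝ F] {n : ℕ} {z : ℝ → F} {G : F → F} {s : Set ℝ} {t : ℝ} (ht : t ∈ s)
    (hz : ∀ᶠ r in 𝓝[s] t, HasDerivWithinAt z (G (z r)) s r)
    (hn : ContDiffWithinAt ℝ n z s t) (hG : ContDiffAt ℝ n G (z t)) :
    ContDiffWithinAt ℝ (n + 1) z s t := by
  rw [contDiffWithinAt_succ_iff_hasFDerivWithinAt (by simp)]
  rw [insert_eq_of_mem ht]
  refine ⟨_, Filter.inter_mem hz self_mem_nhdsWithin, by simp, fun r =>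
    (1 : ℝ →L[ℝ] ℝ).smulRight (G (z r)), fun r hr => ?_, ?_⟩
  · exact (hasDerivWithinAt_iff_hasFDerivWithinAt.1 hr.1).mono inter_subset_right
  · exact contDiffWithinAt_const.smulRight ((hG.comp_contDiffWithinAt t hn).mono inter_subset_right)

section Charts

variable {d : ℕ} {M : Type*} [TopologicalSpace M] [ChartedSpace (Model d) M]
  [IsManifold (𝓡 d) ∞ M] {h : CotangentBundle d M → ℝ}

/-- A curve in `T*M` satisfies Hamilton's equations at a point if it does so in the preferred chart
at that point. -/
theorem hasMFDerivWithinAt_hamiltonianVectorField_iff {Γ : ℝ → CotangentBundle d M} {s : Set ℝ}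
    {t : ℝ} :
    HasMFDerivWithinAt 𝓘(ℝ, ℝ) (cotangentModel d) Γ s t
      ((1 : ℝ →L[ℝ] ℝ).smulRight (hamiltonianVectorField h (Γ t))) ↔
    ContinuousWithinAt Γ s t ∧ HasDerivWithinAt (fun r => cotangentChart (Γ t).1 (Γ r))
      (hamiltonianVector (Model d)
        (fderiv ℝ (chartHam h (Γ t).1) (cotangentChart (Γ t).1 (Γ t)))) s t := by
  have h2 : ∀ v : Model d × (Model d →L[ℝ] ℝ), ContinuousLinearMap.toSpanSingleton ℝ v =
      (1 : ℝ →L[ℝ] ℝ).smulRight v := fun v => by ext1; simp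
  rw [hasDerivWithinAt_iff_hasFDerivWithinAt, h2]
  have h1 : ((extChartAt 𝓘(ℝ, ℝ) t).symm ⁻¹' s ∩ range 𝓘(ℝ, ℝ)) = s := by
    simp only [mfld_simps]
    rfl
  constructor
  · rintro ⟨hc, hd⟩
    rw [h1] at hd
    exact ⟨hc, hd⟩
  · rintro ⟨hc, hd⟩
    refine ⟨hc, ?_⟩
    rw [h1]
    exact hd

theorem hasFDerivAt_extChartAt_comp_symm {x₀ x₁ x : M} (h0 : x ∈ (extChartAt (𝓡 d) x₀).source)
    (h1 : x ∈ (extChartAt (𝓡 d) x₁).source) :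
    HasFDerivAt (fun q => extChartAt (𝓡 d) x₀ ((extChartAt (𝓡 d) x₁).symm q))
      ((chartDeriv x₀ x).comp (chartDerivSymm x₁ x)) (extChartAt (𝓡 d) x₁ x) := by
  have := isManifold_one (d := d) (M := M)
  have hx := (extChartAt (𝓡 d) x₁).left_inv h1
  have h2 := hasFDerivWithinAt_extChartAt_comp (x₀ := x₀)
    (mdifferentiableWithinAt_extChartAt_symm (I := 𝓡 d) ((extChartAt (𝓡 d) x₁).map_source h1))
    (by rwa [hx])
  rw [hx] at h2
  have h3 : range (𝓡 d) = univ := (𝓡 d).range_eq_univ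
  have h4 := h2.mono (s := univ) (by rw [h3])
  rwa [hasFDerivWithinAt_univ] at h4

theorem contDiffAt_extChartAt_comp_symm {F E' H : Type*} [NormedAddCommGroup E']
    [NormedSpace ℝ E'] [TopologicalSpace H] {I : ModelWithCorners ℝ E' H} [I.Boundaryless]
    [TopologicalSpace F] [ChartedSpace H F] [IsManifold I ∞ F] {x₀ x₁ x : F}
    (h0 : x ∈ (extChartAt I x₀).source) (h1 : x ∈ (extChartAt I x₁).source) :
    ContDiffAt ℝ ∞ (fun q => extChartAt I x₀ ((extChartAt I x₁).symm q)) (extChartAt I x₁ x) := by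
  have h2 := contDiffWithinAt_ext_coord_change (I := I) (n := ∞) x₀ x₁ (y := extChartAt I x₁ x)
    ⟨(extChartAt I x₁).map_source h1, by
      rw [mem_preimage]
      change (extChartAt I x₁).symm _ ∈ _
      rwa [(extChartAt I x₁).left_inv h1]⟩
  rw [I.range_eq_univ, contDiffWithinAt_univ] at h2
  exact h2

/-- Hamilton's equations hold in all charts. -/
theorem hasDerivWithinAt_cotangentChart (h_smooth : ContMDiff (cotangentModel d) 𝓘(ℝ, ℝ) ∞ h)
    {Γ : ℝ → CotangentBundle d M} {s : Set ℝ} {t : ℝ}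
    (hΓ : HasMFDerivWithinAt 𝓘(ℝ, ℝ) (cotangentModel d) Γ s t
      ((1 : ℝ →L[ℝ] ℝ).smulRight (hamiltonianVectorField h (Γ t)))) {x₀ : M}
    (hx : (Γ t).1 ∈ (extChartAt (𝓡 d) x₀).source) :
    HasDerivWithinAt (fun r => cotangentChart x₀ (Γ r))
      (hamiltonianVector (Model d) (fderiv ℝ (chartHam h x₀) (cotangentChart x₀ (Γ t)))) s t := by
  obtain ⟨hcont, hder⟩ := hasMFDerivWithinAt_hamiltonianVectorField_iff.1 hΓ
  set x₁ := (Γ t).1 with hx₁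
  have hx1 : x₁ ∈ (extChartAt (𝓡 d) x₁).source := mem_extChartAt_source x₁
  have hsrc1 : Γ t ∈ (cotangentChart x₁).source := mem_cotangentChart_source.2 hx1
  have hsrc0 : Γ t ∈ (cotangentChart x₀).source := mem_cotangentChart_source.2 hx
  set z := cotangentChart x₁ (Γ t) with hz
  have hz1 : z.1 = extChartAt (𝓡 d) x₁ x₁ := by rw [hz, cotangentChart_apply hx1]
  set T : Model d × (Model d →L[ℝ] ℝ) → Model d × (Model d →L[ℝ] ℝ) :=
    fun w => cotangentChart x₀ ((cotangentChart x₁).symm w) with hTdef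
  set τ : Model d → Model d := fun q => extChartAt (𝓡 d) x₀ ((extChartAt (𝓡 d) x₁).symm q) with hτ
  have hTz : T z = cotangentChart x₀ (Γ t) := by
    simp only [hTdef, hz]; rw [(cotangentChart x₁).left_inv hsrc1]
  have hTcont : ContDiffAt ℝ ∞ T z := contDiffAt_extChartAt_comp_symm hsrc0 hsrc1
  have hτcont : ContDiffAt ℝ ∞ τ z.1 := by
    rw [hz1]; exact contDiffAt_extChartAt_comp_symm hx hx1
  -- near `z`, the base point stays in the domains of both charts
  have hnear : ∀ᶠ w : Model d × (Model d →L[ℝ] ℝ) in 𝓝 z,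
      w.1 ∈ (extChartAt (𝓡 d) x₁).target ∧
        (extChartAt (𝓡 d) x₁).symm w.1 ∈ (extChartAt (𝓡 d) x₀).source := by
    have h1 : ∀ᶠ q in 𝓝 z.1, q ∈ (extChartAt (𝓡 d) x₁).target ∧
        (extChartAt (𝓡 d) x₁).symm q ∈ (extChartAt (𝓡 d) x₀).source := by
      rw [hz1]
      refine Filter.Eventually.and (extChartAt_target_mem_nhds (I := 𝓡 d) x₁)
        ((continuousAt_extChartAt_symm x₁).eventually ?_)
      rw [(extChartAt (𝓡 d) x₁).left_inv hx1]
      exact (isOpen_extChartAt_source x₀).mem_nhds hx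
    exact continuousAt_fst.eventually h1
  have hT : ∀ w : Model d × (Model d →L[ℝ] ℝ), w.1 ∈ (extChartAt (𝓡 d) x₁).target →
      (extChartAt (𝓡 d) x₁).symm w.1 ∈ (extChartAt (𝓡 d) x₀).source →
      T w = (τ w.1, (w.2.comp (chartDeriv x₁ ((extChartAt (𝓡 d) x₁).symm w.1))).comp
        (chartDerivSymm x₀ ((extChartAt (𝓡 d) x₁).symm w.1))) := by
    intro w hw1 hw0
    simp only [hTdef]
    rw [← Prod.mk.eta (p := w), cotangentChart_symm_apply hw1]
    exact cotangentChart_apply (y := mkCotangent ((extChartAt (𝓡 d) x₁).symm w.1) _) hw0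
  have hτ' : ∀ q ∈ (extChartAt (𝓡 d) x₁).target,
      (extChartAt (𝓡 d) x₁).symm q ∈ (extChartAt (𝓡 d) x₀).source →
      fderiv ℝ τ q = (chartDeriv x₀ ((extChartAt (𝓡 d) x₁).symm q)).comp
        (chartDerivSymm x₁ ((extChartAt (𝓡 d) x₁).symm q)) := by
    intro q hq1 hq0
    have h1 := hasFDerivAt_extChartAt_comp_symm hq0 ((extChartAt (𝓡 d) x₁).map_target hq1)
    rw [(extChartAt (𝓡 d) x₁).right_inv hq1] at h1
    exact h1.fderiv
  have hT' := (hTcont.differentiableAt (by simp)).hasFDerivAt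
  have hHam : DifferentiableAt ℝ (chartHam h x₀) (T z) := by
    rw [hTz, cotangentChart_apply hx]
    exact ((contDiffOn_chartHam h_smooth x₀).contDiffAt
      (((isOpen_extChartAt_target x₀).prod isOpen_univ).mem_nhds
        ⟨(extChartAt (𝓡 d) x₀).map_source hx, mem_univ _⟩)).differentiableAt (by simp)
  have hsurj : Function.Surjective (fderiv ℝ τ z.1) := by
    intro y
    obtain ⟨h1, h0⟩ := hnear.self_of_nhds
    have hx1' := (extChartAt (𝓡 d) x₁).map_target h1
    rw [hτ' z.1 h1 h0]
    exact ⟨chartDeriv x₁ _ (chartDerivSymm x₀ _ y),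
      (congrArg (chartDeriv x₀ _) (chartDerivSymm_chartDeriv_apply hx1' _)).trans
        (chartDeriv_symm_apply h0 y)⟩
  have key : fderiv ℝ T z (hamiltonianVector (Model d) (fderiv ℝ (chartHam h x₁) z)) =
      hamiltonianVector (Model d) (fderiv ℝ (chartHam h x₀) (T z)) := by
    refine eq_hamiltonianVector (hamiltonian_vector_of_cotangent_lift (τ := τ) hT' ?_ ?_
      (hτcont.of_le (WithTop.coe_le_coe.2 le_top)) hsurj ?_ hHam (hamiltonianVector_spec _))
    · filter_upwards [hnear] with w hw
      rw [hT w hw.1 hw.2]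
    · filter_upwards [hnear] with w hw
      rw [hT w hw.1 hw.2, hτ' w.1 hw.1 hw.2]
      ext y
      have hx1' := (extChartAt (𝓡 d) x₁).map_target hw.1
      simp only [ContinuousLinearMap.comp_apply]
      rw [chartDerivSymm_chartDeriv_apply hw.2, chartDeriv_symm_apply hx1']
    · filter_upwards [hnear] with w hw
      simp only [Function.comp_apply, chartHam, hTdef]
      rw [(cotangentChart x₀).left_inv]
      rw [mem_cotangentChart_source, ← Prod.mk.eta (p := w), cotangentChart_symm_apply hw.1]
      exact hw.2
  have h1 := HasFDerivAt.comp_hasDerivWithinAt (f := fun r => cotangentChart x₁ (Γ r)) t hT' hder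
  rw [key, hTz] at h1
  have hev : ∀ᶠ r in 𝓝[s] t, Γ r ∈ (cotangentChart x₁).source :=
    hcont ((isOpen_extChartAt_source _).mem_nhds hsrc1)
  refine h1.congr_of_eventuallyEq ?_ hTz.symm
  filter_upwards [hev] with r hr
  simp only [Function.comp_apply, hTdef]
  rw [(cotangentChart x₁).left_inv hr]

/-! ### The first variation of length -/

section Variation

variable {E a b δ : ℝ} {γ : ℝ → M} {c : ℝ × ℝ → M}

/-- The momentum `ξ_h(γ, γ̇)` along a curve, in the chart at `x₀`. -/
noncomputable def curveMomentum (h : CotangentBundle d M → ℝ) (a b : ℝ) (γ : ℝ → M) (x₀ : M)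
    (t : ℝ) : Model d →L[ℝ] ℝ :=
  chartInv h x₀ (extChartAt (𝓡 d) x₀ (γ t), chartDeriv x₀ (γ t) (modelVelocity a b γ t))

/-- The differential of a variation `c`, in the chart at `x₀`. -/
noncomputable def variationDeriv (d : ℕ) {M : Type*} [TopologicalSpace M]
    [ChartedSpace (Model d) M] (a b δ : ℝ) (c : ℝ × ℝ → M) (x₀ : M) (z : ℝ × ℝ) :
    ℝ × ℝ →L[ℝ] Model d :=
  fderivWithin ℝ (fun w => extChartAt (𝓡 d) x₀ (c w)) (Icc a b ×ˢ Ioo (-δ) δ) z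

theorem hasDerivAt_curveLength_variation
    (hC : ∀ x₀ : M, IsLegendreChart (extChartAt (𝓡 d) x₀).target (chartHam h x₀) (chartInv h x₀))
    (hab : a < b) (hδ : 0 < δ) (hc : IsRegularVariation d (regularSet h E) a b γ δ c) :
    HasDerivAt (fun u => curveLength (finslerFunction h E) a b fun t => c (t, u))
      (∫ t in a..b, deriv (fun u => modelFinsler h E (c (t, u))
        (modelVelocity a b (fun s => c (s, u)) t)) 0) 0 :=
  hasDerivAt_integral_of_contDiffOn hab hδ (contDiffOn_modelFinsler_variation hC hab hc)

theorem variationDeriv_fst (hab : a < b) (hδ : 0 < δ)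
    (hγ : IsRegularCurve d (regularSet h E) a b γ)
    (hc : IsRegularVariation d (regularSet h E) a b γ δ c) {t : ℝ} (ht : t ∈ Icc a b) {x₀ : M}
    (hx : γ t ∈ (extChartAt (𝓡 d) x₀).source) :
    variationDeriv d a b δ c x₀ (t, 0) (1, 0) = chartDeriv x₀ (γ t) (modelVelocity a b γ t) := by
  have h0 : (0 : ℝ) ∈ Ioo (-δ) δ := ⟨neg_lt_zero.2 hδ, hδ⟩
  have hx' : c (t, 0) ∈ (extChartAt (𝓡 d) x₀).source := by rwa [hc.center t ht]
  have h1 := hasDerivWithinAt_extChartAt_comp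
    ((hγ.contMDiffOn t ht).mdifferentiableWithinAt (by norm_num)) hx
  have h2 := hasDerivWithinAt_fst_of_hasFDerivWithinAt (t := t) h0
    ((contDiffWithinAt_extChartAt_comp (hc.contMDiffOn (t, 0) ⟨ht, h0⟩)
      hx').differentiableWithinAt (by norm_num)).hasFDerivWithinAt
  refine (uniqueDiffOn_Icc hab t ht).eq_deriv _ h2 (h1.congr (fun s hs => ?_) ?_)
  · simp only [hc.center s hs]
  · simp only [hc.center t ht]

theorem variationDeriv_snd (hδ : 0 < δ)
    (hc : IsRegularVariation d (regularSet h E) a b γ δ c) {t : ℝ} (ht : t ∈ Icc a b) {x₀ : M}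
    (hx : γ t ∈ (extChartAt (𝓡 d) x₀).source) :
    HasDerivAt (fun u => extChartAt (𝓡 d) x₀ (c (t, u)))
      (variationDeriv d a b δ c x₀ (t, 0) (0, 1)) 0 := by
  have h0 : (0 : ℝ) ∈ Ioo (-δ) δ := ⟨neg_lt_zero.2 hδ, hδ⟩
  have hx' : c (t, 0) ∈ (extChartAt (𝓡 d) x₀).source := by rwa [hc.center t ht]
  exact hasDerivAt_snd_of_hasFDerivWithinAt (t := t) ht h0
    ((contDiffWithinAt_extChartAt_comp (hc.contMDiffOn (t, 0) ⟨ht, h0⟩)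
      hx').differentiableWithinAt (by norm_num)).hasFDerivWithinAt

omit [IsManifold (𝓡 d) ∞ M] in
theorem eventually_curve_mem_source (hγ : IsRegularCurve d (regularSet h E) a b γ) {t : ℝ}
    (ht : t ∈ Icc a b) {x₀ : M} (hx : γ t ∈ (extChartAt (𝓡 d) x₀).source) :
    ∀ᶠ s in 𝓝[Icc a b] t, s ∈ Icc a b ∧ γ s ∈ (extChartAt (𝓡 d) x₀).source :=
  Filter.Eventually.and self_mem_nhdsWithin (eventually_mem_source
    (hγ.contMDiffOn t ht).continuousWithinAt hx)

/-- The first variation formula at a point of a curve of energy `E`. -/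
theorem first_variation
    (hC : ∀ x₀ : M, IsLegendreChart (extChartAt (𝓡 d) x₀).target (chartHam h x₀) (chartInv h x₀))
    (hab : a < b) (hδ : 0 < δ) (hγ : IsRegularCurve d (regularSet h E) a b γ)
    (hc : IsRegularVariation d (regularSet h E) a b γ δ c) {t : ℝ} (ht : t ∈ Icc a b) {x₀ : M}
    (hx : γ t ∈ (extChartAt (𝓡 d) x₀).source)
    (hE : modelEnergy h (γ t) (modelVelocity a b γ t) = E) {p' : Model d →L[ℝ] ℝ}
    (hp : HasDerivWithinAt (curveMomentum h a b γ x₀) p' (Icc a b) t) :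
    ∃ g : ℝ, HasDerivWithinAt (fun s => curveMomentum h a b γ x₀ s
        (variationDeriv d a b δ c x₀ (s, 0) (0, 1))) g (Icc a b) t ∧
      HasDerivAt (fun u => modelFinsler h E (c (t, u)) (modelVelocity a b (fun s => c (s, u)) t))
        (g - (p' (variationDeriv d a b δ c x₀ (t, 0) (0, 1)) + fderiv ℝ (chartHam h x₀)
          (extChartAt (𝓡 d) x₀ (γ t), curveMomentum h a b γ x₀ t)
            (variationDeriv d a b δ c x₀ (t, 0) (0, 1), 0))) 0 := by
  have h0 : (0 : ℝ) ∈ Ioo (-δ) δ := ⟨neg_lt_zero.2 hδ, hδ⟩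
  have hx' : c (t, 0) ∈ (extChartAt (𝓡 d) x₀).source := by rwa [hc.center t ht]
  have hmom : ∀ s ∈ Icc a b, γ s ∈ (extChartAt (𝓡 d) x₀).source →
      chartInv h x₀ (extChartAt (𝓡 d) x₀ (c (s, 0)),
        variationDeriv d a b δ c x₀ (s, 0) (1, 0)) = curveMomentum h a b γ x₀ s := by
    intro s hs hxs
    rw [variationDeriv_fst hab hδ hγ hc hs hxs, hc.center s hs, curveMomentum]
  have hmem := variation_mem_slitDomain hab hc (z := (t, 0)) ⟨ht, h0⟩ hx'
  have hq := contDiffWithinAt_extChartAt_comp (hc.contMDiffOn (t, 0) ⟨ht, h0⟩) hx'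
  have hev := eventually_curve_mem_source hγ ht hx
  obtain ⟨g, hg1, hg2⟩ := (hC x₀).first_variation hab hδ ht
    (q := fun w => extChartAt (𝓡 d) x₀ (c w)) (Dq := variationDeriv d a b δ c x₀) rfl hq hmem
    (E := E) (p' := p') (by rw [hmom t ht hx, ← hE, modelEnergy_eq hx, hc.center t ht]; rfl)
    (hp.congr_of_eventuallyEq (by
      filter_upwards [hev] with s hs using hmom s hs.1 hs.2) (hmom t ht hx))
  rw [hmom t ht hx, hc.center t ht] at hg2
  refine ⟨g, hg1.congr_of_eventuallyEq ?_ ?_, hg2.congr_of_eventuallyEq ?_⟩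
  · filter_upwards [hev] with s hs
    rw [hmom s hs.1 hs.2]
  · rw [hmom t ht hx]
  · have h1 : ContinuousAt (fun u => c (t, u)) 0 :=
      ((hc.contMDiffOn.continuousOn.comp (f := fun u : ℝ => (t, u)) (by fun_prop)
        fun u hu => ⟨ht, hu⟩)).continuousAt (isOpen_Ioo.mem_nhds h0)
    filter_upwards [isOpen_Ioo.mem_nhds h0,
      h1.eventually ((isOpen_extChartAt_source x₀).mem_nhds hx')] with u hu hux
    exact modelFinsler_variation_eq hab hc (z := (t, u)) ⟨ht, hu⟩ hux

end Variation

/-- A tangent vector of energy `E` over `{h (·, 0) < E}` does not vanish. -/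
theorem ne_zero_of_modelEnergy_eq
    (hC : ∀ x₀ : M, IsLegendreChart (extChartAt (𝓡 d) x₀).target (chartHam h x₀) (chartInv h x₀))
    {E : ℝ} {x : M} (hx : x ∈ regularSet h E) {v : Model d} (hv : modelEnergy h x v = E) :
    v ≠ 0 := by
  rintro rfl
  have hxs := mem_extChartAt_source (I := 𝓡 d) x
  rw [modelEnergy_eq hxs, map_zero, (hC x).inv_zero ((extChartAt (𝓡 d) x).map_source hxs),
    chartHam_extChartAt hxs, ContinuousLinearMap.zero_comp] at hv
  exact hx hv.ge

/-! ### Base integral curves are geodesics -/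

section IntegralCurve

variable {E a b : ℝ} {γ : ℝ → M} {Γ : ℝ → CotangentBundle d M}

set_option synthInstance.maxHeartbeats 200000 in
theorem contDiffAt_hamiltonianVector (h_smooth : ContMDiff (cotangentModel d) 𝓘(ℝ, ℝ) ∞ h)
    {x₀ : M} {z : Model d × (Model d →L[ℝ] ℝ)} (hz : z.1 ∈ (extChartAt (𝓡 d) x₀).target) :
    ContDiffAt ℝ 1 (fun w => hamiltonianVector (Model d) (fderiv ℝ (chartHam h x₀) w)) z := by
  have h1 : ContDiffAt ℝ ∞ (chartHam h x₀) z := (contDiffOn_chartHam h_smooth x₀).contDiffAt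
    (((isOpen_extChartAt_target x₀).prod isOpen_univ).mem_nhds ⟨hz, mem_univ _⟩)
  exact (hamiltonianVector (Model d)).contDiff.contDiffAt.comp z
    (h1.fderiv_right (m := 1) (WithTop.coe_le_coe.2 le_top))

theorem eventually_integralCurve_mem_source
    (hΓ : IsMIntegralCurveOn Γ (hamiltonianVectorField h) (Icc a b)) {t : ℝ} (ht : t ∈ Icc a b)
    {x₀ : M} (hx : (Γ t).1 ∈ (extChartAt (𝓡 d) x₀).source) :
    ∀ᶠ s in 𝓝[Icc a b] t, s ∈ Icc a b ∧ (Γ s).1 ∈ (extChartAt (𝓡 d) x₀).source := by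
  have h1 : ∀ᶠ s in 𝓝[Icc a b] t, Γ s ∈ (cotangentChart x₀).source :=
    (hΓ t ht).1 ((isOpen_extChartAt_source _).mem_nhds (mem_cotangentChart_source.2 hx))
  filter_upwards [self_mem_nhdsWithin, h1] with s hs hs' using ⟨hs, mem_cotangentChart_source.1 hs'⟩

theorem contDiffWithinAt_integralCurve (h_smooth : ContMDiff (cotangentModel d) 𝓘(ℝ, ℝ) ∞ h)
    (hΓ : IsMIntegralCurveOn Γ (hamiltonianVectorField h) (Icc a b)) {t : ℝ} (ht : t ∈ Icc a b)
    {x₀ : M} (hx : (Γ t).1 ∈ (extChartAt (𝓡 d) x₀).source) :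
    ContDiffWithinAt ℝ 2 (fun s => cotangentChart x₀ (Γ s)) (Icc a b) t := by
  have hev := eventually_integralCurve_mem_source hΓ ht hx
  have hode : ∀ᶠ s in 𝓝[Icc a b] t, HasDerivWithinAt (fun s => cotangentChart x₀ (Γ s))
      (hamiltonianVector (Model d) (fderiv ℝ (chartHam h x₀) (cotangentChart x₀ (Γ s))))
      (Icc a b) s := by
    filter_upwards [hev] with s hs
      using hasDerivWithinAt_cotangentChart h_smooth (hΓ s hs.1) hs.2
  have hG : ContDiffAt ℝ 1 (fun w => hamiltonianVector (Model d) (fderiv ℝ (chartHam h x₀) w))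
      (cotangentChart x₀ (Γ t)) := by
    refine contDiffAt_hamiltonianVector h_smooth ?_
    rw [cotangentChart_apply hx]
    exact (extChartAt (𝓡 d) x₀).map_source hx
  have h0 : ContDiffWithinAt ℝ (0 : ℕ) (fun s => cotangentChart x₀ (Γ s)) (Icc a b) t := by
    rw [Nat.cast_zero, contDiffWithinAt_zero ht]
    refine ⟨_, hode, fun s hs => ?_⟩
    exact hs.2.continuousWithinAt.mono inter_subset_left
  have h1 := contDiffWithinAt_succ_of_hasDerivWithinAt
    (G := fun w => hamiltonianVector (Model d) (fderiv ℝ (chartHam h x₀) w)) ht hode h0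
    (hG.of_le (by simp))
  have h2 := contDiffWithinAt_succ_of_hasDerivWithinAt (n := 1)
    (G := fun w => hamiltonianVector (Model d) (fderiv ℝ (chartHam h x₀) w)) ht hode
    (h1.of_le (by norm_num)) (hG.of_le (by norm_num))
  exact h2.of_le (by norm_num)

theorem contMDiffOn_of_isMIntegralCurveOn (h_smooth : ContMDiff (cotangentModel d) 𝓘(ℝ, ℝ) ∞ h)
    (hΓ : IsMIntegralCurveOn Γ (hamiltonianVectorField h) (Icc a b))
    (hΓγ : ∀ t ∈ Icc a b, (Γ t).proj = γ t) :
    ContMDiffOn 𝓘(ℝ, ℝ) (𝓡 d) 2 γ (Icc a b) := by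
  intro t ht
  have hx := mem_extChartAt_source (I := 𝓡 d) (Γ t).1
  have hcont : ContinuousWithinAt γ (Icc a b) t := by
    have h1 : ContinuousWithinAt (fun s => (Γ s).1) (Icc a b) t :=
      (FiberBundle.continuous_proj (Model d →L[ℝ] ℝ)
        (fun x : M => TangentSpace (𝓡 d) x →L[ℝ] ℝ)).continuousAt.comp_continuousWithinAt
          (hΓ t ht).1
    exact h1.congr (fun s hs => (hΓγ s hs).symm) (hΓγ t ht).symm
  refine contMDiffWithinAt_of_extChartAt_comp (x₀ := (Γ t).1) hcont
    (by rw [← hΓγ t ht]; exact hx) ?_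
  refine (contDiffWithinAt_integralCurve h_smooth hΓ ht hx).fst.congr_of_eventuallyEq ?_ ?_
  · filter_upwards [eventually_integralCurve_mem_source hΓ ht hx] with s hs
    rw [cotangentChart_apply hs.2, hΓγ s hs.1]
  · rw [cotangentChart_apply hx, hΓγ t ht]

/-- Along a base integral curve, `ξ_h(γ, γ̇)` is the momentum of the integral curve. -/
theorem curveMomentum_integralCurve (h_smooth : ContMDiff (cotangentModel d) 𝓘(ℝ, ℝ) ∞ h)
    (hC : ∀ x₀ : M, IsLegendreChart (extChartAt (𝓡 d) x₀).target (chartHam h x₀) (chartInv h x₀))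
    (hab : a < b) (hΓ : IsMIntegralCurveOn Γ (hamiltonianVectorField h) (Icc a b))
    (hΓγ : ∀ t ∈ Icc a b, (Γ t).proj = γ t) {t : ℝ} (ht : t ∈ Icc a b)
    {x₀ : M} (hx : (Γ t).1 ∈ (extChartAt (𝓡 d) x₀).source) :
    cotangentChart x₀ (Γ t) = (extChartAt (𝓡 d) x₀ (γ t), curveMomentum h a b γ x₀ t) := by
  have hfst : ∀ s ∈ Icc a b, (Γ s).1 ∈ (extChartAt (𝓡 d) x₀).source →
      (cotangentChart x₀ (Γ s)).1 = extChartAt (𝓡 d) x₀ (γ s) := fun s hs hxs => by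
    rw [cotangentChart_apply hxs, hΓγ s hs]
  have hxγ : γ t ∈ (extChartAt (𝓡 d) x₀).source := by rw [← hΓγ t ht]; exact hx
  have h1 := hasDerivWithinAt_cotangentChart h_smooth (hΓ t ht) hx
  have h2 := hasDerivWithinAt_extChartAt_comp
    ((contMDiffOn_of_isMIntegralCurveOn h_smooth hΓ hΓγ t ht).mdifferentiableWithinAt
      (by norm_num)) hxγ
  have h3 : HasDerivWithinAt (fun s => (cotangentChart x₀ (Γ s)).1)
      (hamiltonianVector (Model d)
        (fderiv ℝ (chartHam h x₀) (cotangentChart x₀ (Γ t)))).1 (Icc a b) t :=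
    (ContinuousLinearMap.fst ℝ (Model d) (Model d →L[ℝ] ℝ)).hasFDerivAt.comp_hasDerivWithinAt t h1
  have h4 : (hamiltonianVector (Model d)
      (fderiv ℝ (chartHam h x₀) (cotangentChart x₀ (Γ t)))).1 =
      chartDeriv x₀ (γ t) (modelVelocity a b γ t) := by
    refine (uniqueDiffOn_Icc hab t ht).eq_deriv _ h3 (h2.congr_of_eventuallyEq ?_ (hfst t ht hx))
    filter_upwards [eventually_integralCurve_mem_source hΓ ht hx] with s hs using hfst s hs.1 hs.2
  refine Prod.ext (hfst t ht hx) ?_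
  refine (hC x₀).eq_inv ((extChartAt (𝓡 d) x₀).map_source hxγ) fun η => ?_
  rw [← hfst t ht hx, Prod.mk.eta, ← hamiltonianVector_spec, h4]
  simp

theorem isFinslerGeodesic_of_isBaseIntegralCurve
    (h_smooth : ContMDiff (cotangentModel d) 𝓘(ℝ, ℝ) ∞ h)
    (hC : ∀ x₀ : M, IsLegendreChart (extChartAt (𝓡 d) x₀).target (chartHam h x₀) (chartInv h x₀))
    (hab : a < b) (hγ : ∀ t ∈ Icc a b, γ t ∈ regularSet h E) (hint : IsBaseIntegralCurve h a b γ)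
    (hE : ∀ t ∈ Icc a b, energy h (γ t) (velocity a b γ t) = E) :
    IsFinslerGeodesic (finslerFunction h E) (regularSet h E) a b γ := by
  obtain ⟨Γ, hΓ, hΓγ⟩ := hint
  have hreg : IsRegularCurve d (regularSet h E) a b γ :=
    { mapsTo := hγ
      contMDiffOn := contMDiffOn_of_isMIntegralCurveOn h_smooth hΓ hΓγ
      velocity_ne_zero := fun t ht => ne_zero_of_modelEnergy_eq hC (hγ t ht) (hE t ht) }
  refine ⟨hreg, fun δ c hδ hc => ?_⟩
  have h0 : (0 : ℝ) ∈ Ioo (-δ) δ := ⟨neg_lt_zero.2 hδ, hδ⟩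
  -- the pairing of the momentum with the variational field, whose derivative is the integrand
  set f : ℝ → ℝ := fun t => modelInv h (γ t) (modelVelocity a b γ t)
    (modelDeriv c (Icc a b ×ˢ Ioo (-δ) δ) (t, 0) (0, 1)) with hf
  have hvar : ∀ t ∈ Icc a b, ∀ x₀ : M, γ t ∈ (extChartAt (𝓡 d) x₀).source →
      variationDeriv d a b δ c x₀ (t, 0) (0, 1) =
        chartDeriv x₀ (γ t) (modelDeriv c (Icc a b ×ˢ Ioo (-δ) δ) (t, 0) (0, 1)) := by
    intro t ht x₀ hx
    have hx' : c (t, 0) ∈ (extChartAt (𝓡 d) x₀).source := by rwa [hc.center t ht]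
    have h1 := hasFDerivWithinAt_extChartAt_comp
      ((hc.contMDiffOn (t, 0) ⟨ht, h0⟩).mdifferentiableWithinAt (by norm_num)) hx'
    rw [variationDeriv, h1.fderivWithin (uniqueDiffOn_variationDomain hab δ (t, 0) ⟨ht, h0⟩),
      ← hc.center t ht]
    rfl
  have hf_eq : ∀ t ∈ Icc a b, ∀ x₀ : M, γ t ∈ (extChartAt (𝓡 d) x₀).source →
      f t = curveMomentum h a b γ x₀ t (variationDeriv d a b δ c x₀ (t, 0) (0, 1)) := by
    intro t ht x₀ hx
    rw [hvar t ht x₀ hx, curveMomentum, chartInv_extChartAt hx, ContinuousLinearMap.comp_apply,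
      chartDerivSymm_chartDeriv_apply hx, chartDerivSymm_chartDeriv_apply hx]
  have hder : ∀ t ∈ Icc a b, HasDerivWithinAt f (deriv (fun u => modelFinsler h E (c (t, u))
      (modelVelocity a b (fun s => c (s, u)) t)) 0) (Icc a b) t := by
    intro t ht
    have hxΓ := mem_extChartAt_source (I := 𝓡 d) (Γ t).1
    have hx : γ t ∈ (extChartAt (𝓡 d) (Γ t).1).source := by rw [← hΓγ t ht]; exact hxΓ
    have hmom := curveMomentum_integralCurve h_smooth hC hab hΓ hΓγ ht hxΓ
    have h1 := hasDerivWithinAt_cotangentChart h_smooth (hΓ t ht) hxΓ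
    have h2 : HasDerivWithinAt (fun s => (cotangentChart (Γ t).1 (Γ s)).2)
        (hamiltonianVector (Model d)
          (fderiv ℝ (chartHam h (Γ t).1) (cotangentChart (Γ t).1 (Γ t)))).2 (Icc a b) t :=
      (ContinuousLinearMap.snd ℝ (Model d) (Model d →L[ℝ] ℝ)).hasFDerivAt.comp_hasDerivWithinAt t h1
    have h3 := h2.congr_of_eventuallyEq (f₁ := curveMomentum h a b γ (Γ t).1) (by
      filter_upwards [eventually_integralCurve_mem_source hΓ ht hxΓ] with s hs
      rw [curveMomentum_integralCurve h_smooth hC hab hΓ hΓγ hs.1 hs.2]) (by rw [hmom])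
    obtain ⟨g, hg1, hg2⟩ := first_variation hC hab hδ hreg hc ht hx (hE t ht) h3
    -- Hamilton's equation for the momentum cancels the remaining term
    have h4 := hamiltonianVector_spec (fderiv ℝ (chartHam h (Γ t).1)
      (cotangentChart (Γ t).1 (Γ t))) (variationDeriv d a b δ c (Γ t).1 (t, 0) (0, 1), 0)
    simp only [zero_apply, zero_sub] at h4
    rw [← hmom, ← h4, add_neg_cancel, sub_zero] at hg2
    rw [hg2.deriv]
    refine hg1.congr_of_eventuallyEq ?_ (hf_eq t ht _ hx)
    filter_upwards [eventually_curve_mem_source hreg ht hx] with s hs using hf_eq s hs.1 _ hs.2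
  have hend : ∀ t ∈ Icc a b, (∀ u ∈ Ioo (-δ) δ, c (t, u) = γ t) → f t = 0 := by
    intro t ht hcon
    have hx := mem_extChartAt_source (I := 𝓡 d) (γ t)
    have h1 := variationDeriv_snd hδ hc ht hx
    have h2 : HasDerivAt (fun u => extChartAt (𝓡 d) (γ t) (c (t, u))) 0 0 := by
      refine (hasDerivAt_const (0 : ℝ) (extChartAt (𝓡 d) (γ t) (γ t))).congr_of_eventuallyEq ?_
      filter_upwards [isOpen_Ioo.mem_nhds h0] with u hu
      rw [hcon u hu]
    rw [hf_eq t ht _ hx, h1.unique h2, map_zero]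
  have hcont : ContinuousOn f (Icc a b) := fun t ht => (hder t ht).continuousWithinAt
  have hint : ∫ t in a..b, deriv (fun u => modelFinsler h E (c (t, u))
      (modelVelocity a b (fun s => c (s, u)) t)) 0 = 0 := by
    rw [intervalIntegral.integral_eq_sub_of_hasDerivAt_of_le hab.le hcont
      (fun t ht => (hder t (Ioo_subset_Icc_self ht)).hasDerivAt (Icc_mem_nhds ht.1 ht.2))
      (ContinuousOn.intervalIntegrable (by
        rw [uIcc_of_le hab.le]
        exact continuousOn_deriv_snd hab hδ (contDiffOn_modelFinsler_variation hC hab hc))),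
      hend a (left_mem_Icc.2 hab.le) hc.left_end, hend b (right_mem_Icc.2 hab.le) hc.right_end,
      sub_zero]
  have := hasDerivAt_curveLength_variation hC hab hδ hc
  rwa [hint] at this

end IntegralCurve

/-! ### Variations supported in a chart -/

section ChartVariation

variable {E a b t₁ t₂ : ℝ} {γ : ℝ → M} {x₀ : M} {χ : ℝ → ℝ} {y : Model d}

/-- The variation of `γ` that is `q + u χ y` in the chart at `x₀`; it is stationary where `χ`
vanishes, and in particular where `γ` is outside of the chart, if `χ` is supported in the chart. -/
noncomputable def chartVariation (γ : ℝ → M) (x₀ : M) (χ : ℝ → ℝ) (y : Model d) (z : ℝ × ℝ) : M :=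
  open Classical in
  if χ z.1 = 0 then γ z.1 else
    (extChartAt (𝓡 d) x₀).symm (extChartAt (𝓡 d) x₀ (γ z.1) + (z.2 * χ z.1) • y)

omit [IsManifold (𝓡 d) ∞ M] in
theorem chartVariation_of_eq_zero {z : ℝ × ℝ} (hz : χ z.1 = 0) :
    chartVariation γ x₀ χ y z = γ z.1 :=
  if_pos hz

omit [IsManifold (𝓡 d) ∞ M] in
theorem chartVariation_of_mem_source {z : ℝ × ℝ} (hz : γ z.1 ∈ (extChartAt (𝓡 d) x₀).source) :
    chartVariation γ x₀ χ y z =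
      (extChartAt (𝓡 d) x₀).symm (extChartAt (𝓡 d) x₀ (γ z.1) + (z.2 * χ z.1) • y) := by
  by_cases h0 : χ z.1 = 0
  · rw [chartVariation_of_eq_zero h0, h0, mul_zero, zero_smul, add_zero,
      (extChartAt (𝓡 d) x₀).left_inv hz]
  · exact if_neg h0

omit [IsManifold (𝓡 d) ∞ M] in
theorem extChartAt_chartVariation {z : ℝ × ℝ} (hz : γ z.1 ∈ (extChartAt (𝓡 d) x₀).source)
    (hz' : extChartAt (𝓡 d) x₀ (γ z.1) + (z.2 * χ z.1) • y ∈ (extChartAt (𝓡 d) x₀).target) :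
    extChartAt (𝓡 d) x₀ (chartVariation γ x₀ χ y z) =
      extChartAt (𝓡 d) x₀ (γ z.1) + (z.2 * χ z.1) • y := by
  rw [chartVariation_of_mem_source hz, (extChartAt (𝓡 d) x₀).right_inv hz']

omit [IsManifold (𝓡 d) ∞ M] in
theorem modelVelocity_congr {γ₁ γ₂ : ℝ → M} {t : ℝ} (ht : t ∈ Icc a b)
    (hγ : γ₁ =ᶠ[𝓝[Icc a b] t] γ₂) :
    modelVelocity (d := d) a b γ₁ t = modelVelocity a b γ₂ t :=
  DFunLike.congr_fun (f := modelDeriv (d := d) γ₁ (Icc a b) t)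
    (g := modelDeriv (d := d) γ₂ (Icc a b) t) (hγ.mfderivWithin_eq_of_mem ht) 1

/-- The velocity of a curve in the chart at `x₀` is of class `C¹`. -/
theorem contDiffWithinAt_chartDeriv_velocity (hab : a < b)
    (hγ : IsRegularCurve d (regularSet h E) a b γ) {t : ℝ} (ht : t ∈ Icc a b)
    (hx : γ t ∈ (extChartAt (𝓡 d) x₀).source) :
    ContDiffWithinAt ℝ 1 (fun s => chartDeriv (d := d) x₀ (γ s) (modelVelocity a b γ s))
      (Icc a b) t := by
  have h1 := ((contDiffWithinAt_extChartAt_comp (hγ.contMDiffOn t ht) hx).fderivWithin_right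
    (m := 1) (uniqueDiffOn_Icc hab) (by norm_num) ht).clm_apply
      (contDiffWithinAt_const (c := (1 : ℝ)))
  have h2 : ∀ s ∈ Icc a b, γ s ∈ (extChartAt (𝓡 d) x₀).source →
      chartDeriv x₀ (γ s) (modelVelocity a b γ s) =
        fderivWithin ℝ (fun s => extChartAt (𝓡 d) x₀ (γ s)) (Icc a b) s 1 := fun s hs hxs =>
    ((hasDerivWithinAt_extChartAt_comp
      ((hγ.contMDiffOn s hs).mdifferentiableWithinAt (by norm_num)) hxs).derivWithin
        (uniqueDiffOn_Icc hab s hs)).symm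
  refine h1.congr_of_eventuallyEq ?_ (h2 t ht hx)
  filter_upwards [eventually_curve_mem_source hγ ht hx] with s hs using h2 s hs.1 hs.2

theorem contDiffWithinAt_curveMomentum
    (hC : ∀ x₀ : M, IsLegendreChart (extChartAt (𝓡 d) x₀).target (chartHam h x₀) (chartInv h x₀))
    (hab : a < b) (hγ : IsRegularCurve d (regularSet h E) a b γ) {t : ℝ} (ht : t ∈ Icc a b)
    (hx : γ t ∈ (extChartAt (𝓡 d) x₀).source) :
    ContDiffWithinAt ℝ 1 (curveMomentum h a b γ x₀) (Icc a b) t := by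
  have h1 : ContDiffAt ℝ 1 (chartInv h x₀)
      (extChartAt (𝓡 d) x₀ (γ t), chartDeriv x₀ (γ t) (modelVelocity a b γ t)) :=
    (hC x₀).contDiffOn_inv.contDiffAt (((isOpen_extChartAt_target x₀).prod isOpen_univ).mem_nhds
      ⟨(extChartAt (𝓡 d) x₀).map_source hx, mem_univ _⟩)
  exact h1.comp_contDiffWithinAt t (((contDiffWithinAt_extChartAt_comp (hγ.contMDiffOn t ht)
    hx).of_le (by norm_num)).prodMk (contDiffWithinAt_chartDeriv_velocity hab hγ ht hx))

/-- For small `u`, the curve `q + u χ y` and its velocity stay in the slit domain. -/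
theorem exists_chartVariation_mem_slitDomain
    (hC : ∀ x₀ : M, IsLegendreChart (extChartAt (𝓡 d) x₀).target (chartHam h x₀) (chartInv h x₀))
    (hab : a < b) (hγ : IsRegularCurve d (regularSet h E) a b γ) (hsub : Icc t₁ t₂ ⊆ Icc a b)
    (hsrc : ∀ t ∈ Icc t₁ t₂, γ t ∈ (extChartAt (𝓡 d) x₀).source) (hχ : ContDiff ℝ ∞ χ) :
    ∃ δ > 0, ∀ u ∈ Ioo (-δ) δ, ∀ t ∈ Icc t₁ t₂,
      (extChartAt (𝓡 d) x₀ (γ t) + (u * χ t) • y,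
        chartDeriv x₀ (γ t) (modelVelocity a b γ t) + (u * deriv χ t) • y) ∈
        slitDomain (extChartAt (𝓡 d) x₀).target (chartHam h x₀) E := by
  have h1 : Continuous (fun t : Icc t₁ t₂ => extChartAt (𝓡 d) x₀ (γ t)) :=
    continuousOn_iff_continuous_domRestrict.1 fun t ht =>
      ((contDiffWithinAt_extChartAt_comp (hγ.contMDiffOn t (hsub ht))
        (hsrc t ht)).continuousWithinAt).mono hsub
  have h2 : Continuous (fun t : Icc t₁ t₂ =>
      chartDeriv (d := d) x₀ (γ t) (modelVelocity a b γ t)) :=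
    continuousOn_iff_continuous_domRestrict.1 fun t ht =>
      ((contDiffWithinAt_chartDeriv_velocity hab hγ (hsub ht)
        (hsrc t ht)).continuousWithinAt).mono hsub
  have h3 : Continuous (deriv χ) := hχ.continuous_deriv (WithTop.coe_le_coe.2 le_top)
  have h4 := hχ.continuous
  have h5 : Continuous (fun z : ℝ × Icc t₁ t₂ =>
      (extChartAt (𝓡 d) x₀ (γ z.2) + (z.1 * χ z.2) • y,
        chartDeriv x₀ (γ z.2) (modelVelocity a b γ z.2) + (z.1 * deriv χ z.2) • y)) :=
    ((h1.comp continuous_snd).add (by fun_prop)).prodMk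
      ((h2.comp continuous_snd).add (by fun_prop))
  have h6 := (isCompact_univ (X := Icc t₁ t₂)).eventually_forall_of_forall_eventually
    (x₀ := (0 : ℝ)) (P := fun u t => (extChartAt (𝓡 d) x₀ (γ t) + (u * χ t) • y,
        chartDeriv x₀ (γ t) (modelVelocity a b γ t) + (u * deriv χ t) • y) ∈
        slitDomain (extChartAt (𝓡 d) x₀).target (chartHam h x₀) E) fun t _ =>
      h5.continuousAt.eventually (((hC x₀).isOpen_slitDomain E).mem_nhds (by
        simp only [zero_mul, zero_smul, add_zero]
        exact mem_slitDomain (hsrc t t.2) (hγ.mapsTo t (hsub t.2))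
          (hγ.velocity_ne_zero t (hsub t.2))))
  obtain ⟨δ, hδ, h7⟩ := Metric.eventually_nhds_iff.1 h6
  refine ⟨δ, hδ, fun u hu t ht => h7 ?_ ⟨t, ht⟩ (mem_univ _)⟩
  rw [Real.dist_eq, sub_zero]
  exact abs_lt.2 hu

omit [IsManifold (𝓡 d) ∞ M] in
theorem eventually_chartVariation_eq {t : ℝ} (ht : t ∉ tsupport χ) :
    ∀ᶠ s in 𝓝 t, ∀ u, chartVariation γ x₀ χ y (s, u) = γ s := by
  filter_upwards [(isClosed_tsupport χ).isOpen_compl.mem_nhds ht] with s hs u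
  exact chartVariation_of_eq_zero (image_eq_zero_of_notMem_tsupport hs)

theorem isRegularVariation_chartVariation (hγ : IsRegularCurve d (regularSet h E) a b γ)
    (hab : a < b) (hsub : Icc t₁ t₂ ⊆ Icc a b)
    (hsrc : ∀ t ∈ Icc t₁ t₂, γ t ∈ (extChartAt (𝓡 d) x₀).source) (hχ : ContDiff ℝ ∞ χ)
    (hsupp : tsupport χ ⊆ Ioo t₁ t₂) {δ : ℝ}
    (hδ : ∀ u ∈ Ioo (-δ) δ, ∀ t ∈ Icc t₁ t₂,
      (extChartAt (𝓡 d) x₀ (γ t) + (u * χ t) • y,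
        chartDeriv x₀ (γ t) (modelVelocity a b γ t) + (u * deriv χ t) • y) ∈
        slitDomain (extChartAt (𝓡 d) x₀).target (chartHam h x₀) E) :
    IsRegularVariation d (regularSet h E) a b γ δ (chartVariation γ x₀ χ y) := by
  have hχ2 : ContDiff ℝ 2 χ := hχ.of_le (WithTop.coe_le_coe.2 le_top)
  have hsub' : Ioo t₁ t₂ ⊆ Icc a b := Ioo_subset_Icc_self.trans hsub
  have hIoo : Ioo t₁ t₂ ⊆ Ioo a b := by
    rw [← interior_Icc, ← interior_Icc]; exact interior_mono hsub
  have hsmooth : ContMDiffOn 𝓘(ℝ, ℝ × ℝ) (𝓡 d) 2 (chartVariation γ x₀ χ y)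
      (Icc a b ×ˢ Ioo (-δ) δ) := by
    rintro ⟨t, u⟩ ⟨ht, hu⟩
    by_cases hts : t ∈ tsupport χ
    · have ht' := hsupp hts
      have hx := hsrc t (Ioo_subset_Icc_self ht')
      have h1 : ContDiffWithinAt ℝ 2 (fun z : ℝ × ℝ => extChartAt (𝓡 d) x₀ (γ z.1) +
          (z.2 * χ z.1) • y) (Icc a b ×ˢ Ioo (-δ) δ) (t, u) := by
        refine ContDiffWithinAt.add ?_ ?_
        · exact ContDiffWithinAt.comp (g := fun s => extChartAt (𝓡 d) x₀ (γ s))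
            (f := (Prod.fst : ℝ × ℝ → ℝ)) (t, u)
            (contDiffWithinAt_extChartAt_comp (hγ.contMDiffOn t ht) hx)
            contDiffWithinAt_fst fun z hz => hz.1
        · exact ((contDiff_snd.mul (hχ2.comp contDiff_fst)).smul contDiff_const).contDiffWithinAt
      have : IsManifold (𝓡 d) 2 M := IsManifold.of_le (n := ∞) (WithTop.coe_le_coe.2 le_top)
      have h2 := ((contMDiffOn_extChartAt_symm (I := 𝓡 d) (n := 2) x₀).contMDiffAt
        ((isOpen_extChartAt_target x₀).mem_nhds
          (hδ u hu t (Ioo_subset_Icc_self ht')).1)).comp_contMDiffWithinAt (t, u)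
            h1.contMDiffWithinAt
      refine h2.congr_of_eventuallyEq ?_ (chartVariation_of_mem_source hx)
      have h3 : ∀ᶠ z : ℝ × ℝ in 𝓝[Icc a b ×ˢ Ioo (-δ) δ] (t, u), z.1 ∈ Ioo t₁ t₂ :=
        Filter.Eventually.filter_mono nhdsWithin_le_nhds
          (continuousAt_fst.eventually (isOpen_Ioo.mem_nhds ht'))
      filter_upwards [h3] with z hz
        using chartVariation_of_mem_source (hsrc z.1 (Ioo_subset_Icc_self hz))
    · have h0 : ContMDiffWithinAt 𝓘(ℝ, ℝ × ℝ) 𝓘(ℝ, ℝ) 2 (Prod.fst : ℝ × ℝ → ℝ)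
          (Icc a b ×ˢ Ioo (-δ) δ) (t, u) := contDiffWithinAt_fst.contMDiffWithinAt
      have h1 : ContMDiffWithinAt 𝓘(ℝ, ℝ × ℝ) (𝓡 d) 2 (fun z : ℝ × ℝ => γ z.1)
          (Icc a b ×ˢ Ioo (-δ) δ) (t, u) :=
        (hγ.contMDiffOn t ht).comp (t, u) h0 fun z hz => hz.1
      have h2 : ∀ᶠ z : ℝ × ℝ in 𝓝 (t, u), ∀ u', chartVariation γ x₀ χ y (z.1, u') = γ z.1 :=
        continuousAt_fst.eventually (eventually_chartVariation_eq hts)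
      exact h1.congr_of_eventuallyEq
        (Filter.Eventually.filter_mono nhdsWithin_le_nhds (h2.mono fun z hz => hz z.2))
        (h2.self_of_nhds u)
  have hsrcV : ∀ u ∈ Ioo (-δ) δ, ∀ t ∈ Ioo t₁ t₂,
      chartVariation γ x₀ χ y (t, u) ∈ (extChartAt (𝓡 d) x₀).source := by
    intro u hu t ht
    rw [chartVariation_of_mem_source (hsrc t (Ioo_subset_Icc_self ht))]
    exact (extChartAt (𝓡 d) x₀).map_target (hδ u hu t (Ioo_subset_Icc_self ht)).1
  have hcV : ∀ u ∈ Ioo (-δ) δ, ∀ t ∈ Ioo t₁ t₂,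
      extChartAt (𝓡 d) x₀ (chartVariation γ x₀ χ y (t, u)) =
        extChartAt (𝓡 d) x₀ (γ t) + (u * χ t) • y := fun u hu t ht =>
    extChartAt_chartVariation (z := (t, u)) (hsrc t (Ioo_subset_Icc_self ht))
      (hδ u hu t (Ioo_subset_Icc_self ht)).1
  have hout : ∀ t ∉ tsupport χ, ∀ u, chartVariation γ x₀ χ y (t, u) = γ t := fun t ht u =>
    chartVariation_of_eq_zero (image_eq_zero_of_notMem_tsupport ht)
  refine
    { contMDiffOn := hsmooth
      regular := fun u hu => ⟨fun t ht => ?_, ?_, fun t ht h0 => ?_⟩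
      center := fun t _ => ?_
      left_end := fun u _ => hout a (fun ha => (hIoo (hsupp ha)).1.false) u
      right_end := fun u _ => hout b (fun hb => (hIoo (hsupp hb)).2.false) u }
  · by_cases hts : t ∈ tsupport χ
    · have ht' := hsupp hts
      have h1 := (hδ u hu t (Ioo_subset_Icc_self ht')).2.1
      rw [← hcV u hu t ht', chartHam_extChartAt (hsrcV u hu t ht'),
        ContinuousLinearMap.zero_comp] at h1
      exact not_le.2 h1
    · rw [hout t hts]
      exact hγ.mapsTo t ht
  · exact hsmooth.comp (contDiff_id.prodMk contDiff_const).contMDiff.contMDiffOn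
      fun t ht => ⟨ht, hu⟩
  · by_cases hts : t ∈ tsupport χ
    · have ht' := hsupp hts
      have hdiff : ContMDiffWithinAt 𝓘(ℝ, ℝ) (𝓡 d) 2
          (fun s => chartVariation γ x₀ χ y (s, u)) (Icc a b) t :=
        (hsmooth.comp (f := fun s : ℝ => (s, u))
          (contDiff_id.prodMk contDiff_const).contMDiff.contMDiffOn fun s hs => ⟨hs, hu⟩) t ht
      have h1 := hasDerivWithinAt_extChartAt_comp (hdiff.mdifferentiableWithinAt (by norm_num))
        (hsrcV u hu t ht')
      have h2 := hasDerivWithinAt_extChartAt_comp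
        ((hγ.contMDiffOn t ht).mdifferentiableWithinAt (by norm_num))
        (hsrc t (Ioo_subset_Icc_self ht'))
      have h3 : HasDerivWithinAt (fun s => (u * χ s) • y) ((u * deriv χ t) • y) (Icc a b) t :=
        (((hχ2.differentiable (by norm_num)).differentiableAt.hasDerivAt.const_mul u).smul_const
          y).hasDerivWithinAt
      have h4 := (uniqueDiffOn_Icc hab t ht).eq_deriv _ h1
        ((h2.add h3).congr_of_eventuallyEq (by
          filter_upwards [mem_nhdsWithin_of_mem_nhds (isOpen_Ioo.mem_nhds ht')] with s hs
            using hcV u hu s hs) (hcV u hu t ht'))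
      have h5 : modelVelocity (d := d) a b (fun s => chartVariation γ x₀ χ y (s, u)) t = 0 := h0
      rw [h5, map_zero] at h4
      exact (hδ u hu t (Ioo_subset_Icc_self ht')).2.2 h4.symm
    · refine hγ.velocity_ne_zero t ht ?_
      have h1 := modelVelocity_congr (d := d) ht (γ₁ := fun s => chartVariation γ x₀ χ y (s, u))
        (γ₂ := γ) (Filter.Eventually.filter_mono nhdsWithin_le_nhds
          ((eventually_chartVariation_eq hts).mono fun s hs => hs u))
      exact h1.symm.trans h0
  · by_cases hts : t ∈ tsupport χ
    · have hx := hsrc t (Ioo_subset_Icc_self (hsupp hts))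
      rw [chartVariation_of_mem_source hx]
      simp only [zero_mul, zero_smul, add_zero]
      exact (extChartAt (𝓡 d) x₀).left_inv hx
    · exact hout t hts 0

end ChartVariation

/-! ### Geodesics of energy `E` are base integral curves -/

section Geodesic

variable {E a b t₁ t₂ : ℝ} {γ : ℝ → M} {x₀ : M} {χ : ℝ → ℝ} {y : Model d}

/-- The left-hand side `p' + ∂H/∂q` of Hamilton's second equation along `γ`, in the chart at `x₀`
and in the direction `y`. -/
noncomputable def hamiltonResidual (h : CotangentBundle d M → ℝ) (a b : ℝ) (γ : ℝ → M) (x₀ : M)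
    (y : Model d) (t : ℝ) : ℝ :=
  derivWithin (curveMomentum h a b γ x₀) (Icc a b) t y + fderiv ℝ (chartHam h x₀)
    (extChartAt (𝓡 d) x₀ (γ t), curveMomentum h a b γ x₀ t) (y, 0)

theorem continuousWithinAt_hamiltonResidual
    (h_smooth : ContMDiff (cotangentModel d) 𝓘(ℝ, ℝ) ∞ h)
    (hC : ∀ x₀ : M, IsLegendreChart (extChartAt (𝓡 d) x₀).target (chartHam h x₀) (chartInv h x₀))
    (hab : a < b) (hγ : IsRegularCurve d (regularSet h E) a b γ) {t : ℝ} (ht : t ∈ Icc a b)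
    (hx : γ t ∈ (extChartAt (𝓡 d) x₀).source) :
    ContinuousWithinAt (hamiltonResidual h a b γ x₀ y) (Icc a b) t := by
  have hP := contDiffWithinAt_curveMomentum hC hab hγ ht hx
  have h1 : ContinuousWithinAt
      (fun s => derivWithin (curveMomentum h a b γ x₀) (Icc a b) s) (Icc a b) t :=
    ((hP.fderivWithin_right (m := 0) (uniqueDiffOn_Icc hab) (by norm_num) ht).clm_apply
      (contDiffWithinAt_const (c := (1 : ℝ)))).continuousWithinAt
  have h2 : ContDiffAt ℝ ∞ (chartHam h x₀) (extChartAt (𝓡 d) x₀ (γ t),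
      curveMomentum h a b γ x₀ t) := (contDiffOn_chartHam h_smooth x₀).contDiffAt
    (((isOpen_extChartAt_target x₀).prod isOpen_univ).mem_nhds
      ⟨(extChartAt (𝓡 d) x₀).map_source hx, mem_univ _⟩)
  have h3 : ContinuousWithinAt (fun s => fderiv ℝ (chartHam h x₀)
      (extChartAt (𝓡 d) x₀ (γ s), curveMomentum h a b γ x₀ s)) (Icc a b) t :=
    ContinuousAt.comp_continuousWithinAt (g := fderiv ℝ (chartHam h x₀))
      (f := fun s => (extChartAt (𝓡 d) x₀ (γ s), curveMomentum h a b γ x₀ s))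
      (h2.fderiv_right (m := 0) (WithTop.coe_le_coe.2 le_top)).continuousAt
      ((contDiffWithinAt_extChartAt_comp (hγ.contMDiffOn t ht) hx).continuousWithinAt.prodMk
        hP.continuousWithinAt)
  exact (h1.clm_apply continuousWithinAt_const).add (h3.clm_apply continuousWithinAt_const)

/-- Along a geodesic of energy `E`, the left-hand side of Hamilton's second equation is orthogonal
to all test functions supported in an interval that `γ` maps into the chart. -/
theorem integral_mul_hamiltonResidual_eq_zero
    (h_smooth : ContMDiff (cotangentModel d) 𝓘(ℝ, ℝ) ∞ h)
    (hC : ∀ x₀ : M, IsLegendreChart (extChartAt (𝓡 d) x₀).target (chartHam h x₀) (chartInv h x₀))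
    (hab : a < b) (hγ : IsFinslerGeodesic (finslerFunction h E) (regularSet h E) a b γ)
    (hE : ∀ t ∈ Icc a b, modelEnergy h (γ t) (modelVelocity a b γ t) = E)
    (hsub : Icc t₁ t₂ ⊆ Icc a b) (hsrc : ∀ t ∈ Icc t₁ t₂, γ t ∈ (extChartAt (𝓡 d) x₀).source)
    (hχ : ContDiff ℝ ∞ χ) (hsupp : tsupport χ ⊆ Ioo t₁ t₂) (y : Model d) :
    ∫ t in a..b, χ t * hamiltonResidual h a b γ x₀ y t = 0 := by
  obtain ⟨hreg, hcrit⟩ := hγ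
  obtain ⟨δ, hδ, hslit⟩ := exists_chartVariation_mem_slitDomain (y := y) hC hab hreg hsub hsrc hχ
  have hc := isRegularVariation_chartVariation hreg hab hsub hsrc hχ hsupp hslit
  have h0 : (0 : ℝ) ∈ Ioo (-δ) δ := ⟨neg_lt_zero.2 hδ, hδ⟩
  have hIoo : Ioo t₁ t₂ ⊆ Ioo a b := by
    rw [← interior_Icc, ← interior_Icc]; exact interior_mono hsub
  set c := chartVariation γ x₀ χ y with hcdef
  set G : ℝ → ℝ := fun t => deriv (fun u => modelFinsler h E (c (t, u))
    (modelVelocity a b (fun s => c (s, u)) t)) 0 with hG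
  have hGint : ∫ t in a..b, G t = 0 :=
    (hasDerivAt_curveLength_variation hC hab hδ hc).unique (hcrit δ c hδ hc)
  have hGcont : ContinuousOn G (Icc a b) :=
    continuousOn_deriv_snd hab hδ (contDiffOn_modelFinsler_variation hC hab hc)
  have hzero : ∀ t ∉ tsupport χ, ∀ᶠ s in 𝓝 t, χ s = 0 := fun t ht => by
    filter_upwards [(isClosed_tsupport χ).isOpen_compl.mem_nhds ht] with s hs
      using image_eq_zero_of_notMem_tsupport hs
  have hrcont : ContinuousOn (fun t => χ t * hamiltonResidual h a b γ x₀ y t) (Icc a b) := by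
    intro t ht
    by_cases hts : t ∈ tsupport χ
    · exact hχ.continuous.continuousWithinAt.mul (continuousWithinAt_hamiltonResidual h_smooth hC
        hab hreg ht (hsrc t (Ioo_subset_Icc_self (hsupp hts))))
    · have h1 : (fun t => χ t * hamiltonResidual h a b γ x₀ y t) =ᶠ[𝓝 t] fun _ => 0 :=
        (hzero t hts).mono fun s hs => by simp only [hs, zero_mul]
      exact (continuousAt_const.congr h1.symm).continuousWithinAt
  -- the variational field is `χ y`
  have hfield : ∀ t ∈ Ioo t₁ t₂, variationDeriv d a b δ c x₀ (t, 0) (0, 1) = χ t • y := by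
    intro t ht
    have hx := hsrc t (Ioo_subset_Icc_self ht)
    have h1 := variationDeriv_snd hδ hc (Ioo_subset_Icc_self (hIoo ht)) hx
    have h2 : HasDerivAt (fun u => extChartAt (𝓡 d) x₀ (γ t) + (u * χ t) • y) (χ t • y) 0 := by
      simpa using ((((hasDerivAt_id (0 : ℝ)).mul_const (χ t)).smul_const y).const_add
        (extChartAt (𝓡 d) x₀ (γ t)))
    refine h1.unique (h2.congr_of_eventuallyEq ?_)
    filter_upwards [isOpen_Ioo.mem_nhds h0] with u hu
    exact extChartAt_chartVariation (z := (t, u)) hx (hslit u hu t (Ioo_subset_Icc_self ht)).1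
  set f : ℝ → ℝ := fun t => curveMomentum h a b γ x₀ t (χ t • y) with hf
  have hder : ∀ t ∈ Icc a b,
      HasDerivWithinAt f (G t + χ t * hamiltonResidual h a b γ x₀ y t) (Icc a b) t := by
    intro t ht
    by_cases hts : t ∈ tsupport χ
    · have ht' := hsupp hts
      have hx := hsrc t (Ioo_subset_Icc_self ht')
      have hP := ((contDiffWithinAt_curveMomentum hC hab hreg ht hx).differentiableWithinAt
        one_ne_zero).hasDerivWithinAt
      obtain ⟨g, hg1, hg2⟩ := first_variation hC hab hδ hreg hc ht hx (hE t ht) hP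
      have hfg : HasDerivWithinAt f g (Icc a b) t := by
        refine hg1.congr_of_eventuallyEq ?_ (by rw [hfield t ht'])
        filter_upwards [mem_nhdsWithin_of_mem_nhds (isOpen_Ioo.mem_nhds ht')] with s hs
        rw [hfield s hs]
      have hGt : G t = g - χ t * hamiltonResidual h a b γ x₀ y t := by
        rw [hG]
        dsimp only
        rw [hg2.deriv, hfield t ht', hamiltonResidual, mul_add]
        have h1 : ((χ t • y, 0) : Model d × (Model d →L[ℝ] ℝ)) = χ t • (y, 0) := by simp
        rw [h1, map_smul, map_smul, smul_eq_mul, smul_eq_mul]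
      rwa [hGt, sub_add_cancel]
    · have h1 : f =ᶠ[𝓝[Icc a b] t] fun _ => 0 :=
        Filter.Eventually.filter_mono nhdsWithin_le_nhds ((hzero t hts).mono fun s hs => by
          simp only [hf, hs, zero_smul, map_zero])
      have hχt : χ t = 0 := image_eq_zero_of_notMem_tsupport hts
      have hGt : G t = 0 := by
        have h2 : ∀ u, modelFinsler h E (c (t, u)) (modelVelocity a b (fun s => c (s, u)) t) =
            modelFinsler h E (γ t) (modelVelocity a b γ t) := by
          intro u
          rw [modelVelocity_congr (γ₁ := fun s => c (s, u)) (γ₂ := γ) ht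
            (Filter.Eventually.filter_mono nhdsWithin_le_nhds
              ((eventually_chartVariation_eq hts).mono fun s hs => hs u)),
            hcdef, chartVariation_of_eq_zero hχt]
        simp only [hG, h2, deriv_const]
      rw [hGt, hχt, zero_mul, add_zero]
      exact (hasDerivWithinAt_const t (Icc a b) (0 : ℝ)).congr_of_eventuallyEq h1
        (h1.self_of_nhdsWithin ht)
  have hend : ∀ t ∉ Ioo a b, f t = 0 := fun t ht => by
    have h1 : χ t = 0 := image_eq_zero_of_notMem_tsupport fun hts => ht (hIoo (hsupp hts))
    simp only [hf, h1, zero_smul, map_zero]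
  have hii : ∀ {r : ℝ → ℝ}, ContinuousOn r (Icc a b) →
      IntervalIntegrable r MeasureTheory.volume a b := fun {r} hr =>
    ContinuousOn.intervalIntegrable (by rwa [uIcc_of_le hab.le])
  have hFTC := intervalIntegral.integral_eq_sub_of_hasDerivAt_of_le hab.le
    (fun t ht => (hder t ht).continuousWithinAt)
    (fun t ht => (hder t (Ioo_subset_Icc_self ht)).hasDerivAt (Icc_mem_nhds ht.1 ht.2))
    ((hii hGcont).add (hii hrcont))
  rwa [intervalIntegral.integral_add (hii hGcont) (hii hrcont), hGint, zero_add,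
    hend a (fun ha => ha.1.false), hend b (fun hb => hb.2.false), sub_zero] at hFTC

/-- Hamilton's second equation along a geodesic of energy `E`. -/
theorem hamiltonResidual_eq_zero (h_smooth : ContMDiff (cotangentModel d) 𝓘(ℝ, ℝ) ∞ h)
    (hC : ∀ x₀ : M, IsLegendreChart (extChartAt (𝓡 d) x₀).target (chartHam h x₀) (chartInv h x₀))
    (hab : a < b) (hγ : IsFinslerGeodesic (finslerFunction h E) (regularSet h E) a b γ)
    (hE : ∀ t ∈ Icc a b, modelEnergy h (γ t) (modelVelocity a b γ t) = E)
    {t : ℝ} (ht : t ∈ Icc a b) (hx : γ t ∈ (extChartAt (𝓡 d) x₀).source) (y : Model d) :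
    hamiltonResidual h a b γ x₀ y t = 0 := by
  obtain ⟨ε, hε, hball⟩ := Metric.mem_nhdsWithin_iff.1 (eventually_curve_mem_source hγ.1 ht hx)
  set t₁ := max a (t - ε / 2) with ht₁
  set t₂ := min b (t + ε / 2) with ht₂
  have h12 : t₁ < t₂ := by
    rw [ht₁, ht₂]
    exact max_lt (lt_min hab (by linarith [ht.1])) (lt_min (by linarith [ht.2]) (by linarith))
  have htI : t ∈ Icc t₁ t₂ :=
    ⟨max_le ht.1 (by linarith), le_min ht.2 (by linarith)⟩
  have hsub : Icc t₁ t₂ ⊆ Icc a b := Icc_subset_Icc (le_max_left _ _) (min_le_left _ _)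
  have hsrc : ∀ s ∈ Icc t₁ t₂, γ s ∈ (extChartAt (𝓡 d) x₀).source := by
    intro s hs
    refine (hball ⟨?_, hsub hs⟩).2
    rw [Metric.mem_ball, Real.dist_eq, abs_lt]
    have h1 := (le_max_right _ _).trans hs.1
    have h2 := hs.2.trans (min_le_right _ _)
    exact ⟨by linarith, by linarith⟩
  have hcont : ContinuousOn (hamiltonResidual h a b γ x₀ y) (Icc t₁ t₂) := fun s hs =>
    (continuousWithinAt_hamiltonResidual h_smooth hC hab hγ.1 (hsub hs) (hsrc s hs)).mono hsub
  have hae := isOpen_Ioo.ae_eq_zero_of_integral_contDiff_smul_eq_zero (μ := MeasureTheory.volume)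
    ((hcont.mono Ioo_subset_Icc_self).locallyIntegrableOn measurableSet_Ioo) (by
      intro g hg _ hsupp
      have h1 := integral_mul_hamiltonResidual_eq_zero h_smooth hC hab hγ hE hsub hsrc hg hsupp y
      rw [intervalIntegral.integral_eq_integral_of_support_subset] at h1
      · exact h1
      · intro s hs
        have h2 := hsupp (subset_tsupport g (left_ne_zero_of_mul hs))
        exact ⟨(le_max_left _ _).trans_lt h2.1, h2.2.le.trans (min_le_left _ _)⟩)
  have hae' : hamiltonResidual h a b γ x₀ y
      =ᵐ[MeasureTheory.volume.restrict (Icc t₁ t₂)] fun _ => 0 := by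
    rw [← MeasureTheory.restrict_Ioo_eq_restrict_Icc]
    exact (MeasureTheory.ae_restrict_iff' measurableSet_Ioo).2 hae
  exact MeasureTheory.Measure.eqOn_Icc_of_ae_eq MeasureTheory.volume h12.ne hae' hcont
    continuousOn_const htI

theorem isBaseIntegralCurve_of_isFinslerGeodesic
    (h_smooth : ContMDiff (cotangentModel d) 𝓘(ℝ, ℝ) ∞ h)
    (hC : ∀ x₀ : M, IsLegendreChart (extChartAt (𝓡 d) x₀).target (chartHam h x₀) (chartInv h x₀))
    (hab : a < b) (hγ : IsFinslerGeodesic (finslerFunction h E) (regularSet h E) a b γ)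
    (hE : ∀ t ∈ Icc a b, energy h (γ t) (velocity a b γ t) = E) :
    IsBaseIntegralCurve h a b γ := by
  set Γ : ℝ → CotangentBundle d M := fun t =>
    mkCotangent (γ t) (modelInv h (γ t) (modelVelocity a b γ t)) with hΓ
  refine ⟨Γ, fun t ht => hasMFDerivWithinAt_hamiltonianVectorField_iff.2 ?_, fun t _ => rfl⟩
  have hx := mem_extChartAt_source (I := 𝓡 d) (γ t)
  have hcoord : ∀ s, γ s ∈ (extChartAt (𝓡 d) (γ t)).source → cotangentChart (γ t) (Γ s) =
      (extChartAt (𝓡 d) (γ t) (γ s), curveMomentum h a b γ (γ t) s) := by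
    intro s hs
    rw [cotangentChart_apply (y := Γ s) hs, curveMomentum, chartInv_extChartAt hs,
      chartDerivSymm_chartDeriv_apply hs]
    rfl
  have hev := eventually_curve_mem_source hγ.1 ht hx
  have hP := ((contDiffWithinAt_curveMomentum hC hab hγ.1 ht hx).differentiableWithinAt
    one_ne_zero).hasDerivWithinAt
  have hQ := hasDerivWithinAt_extChartAt_comp
    ((hγ.1.contMDiffOn t ht).mdifferentiableWithinAt (by norm_num)) hx
  have hder : HasDerivWithinAt (fun s => cotangentChart (γ t) (Γ s))
      (chartDeriv (γ t) (γ t) (modelVelocity a b γ t),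
        derivWithin (curveMomentum h a b γ (γ t)) (Icc a b) t) (Icc a b) t := by
    refine (hQ.prodMk hP).congr_of_eventuallyEq ?_ (hcoord t hx)
    filter_upwards [hev] with s hs using hcoord s hs.2
  -- Hamilton's equations: the Legendre relation and the vanishing of `p' + ∂H/∂q`
  have hham := eq_hamiltonianVector (V := Model d)
    (φ := fderiv ℝ (chartHam h (γ t)) (cotangentChart (γ t) (Γ t)))
    (v := (chartDeriv (γ t) (γ t) (modelVelocity a b γ t),
      derivWithin (curveMomentum h a b γ (γ t)) (Icc a b) t)) (by
    rintro ⟨y, η⟩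
    have h1 := hamiltonResidual_eq_zero h_smooth hC hab hγ hE ht hx y
    have h2 := (hC (γ t)).fderiv_inr _ ((extChartAt (𝓡 d) (γ t)).map_source hx)
      (chartDeriv (γ t) (γ t) (modelVelocity a b γ t)) η
    have h3 : ((y, η) : Model d × (Model d →L[ℝ] ℝ)) = (y, 0) + (0, η) := by simp
    rw [hcoord t hx, h3, map_add]
    rw [hamiltonResidual] at h1
    have h4 : fderiv ℝ (chartHam h (γ t)) (extChartAt (𝓡 d) (γ t) (γ t),
      curveMomentum h a b γ (γ t) t) (0, η) =
        η (chartDeriv (γ t) (γ t) (modelVelocity a b γ t)) := h2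
    rw [h4]
    simp only [Prod.mk_add_mk, add_zero, zero_add]
    linarith)
  refine ⟨?_, hder.congr_deriv hham⟩
  have hmem : ∀ s, γ s ∈ (extChartAt (𝓡 d) (γ t)).source →
      Γ s ∈ (cotangentChart (γ t)).source := fun s hs => mem_cotangentChart_source.2 hs
  have h1 : ContinuousWithinAt (fun s => (cotangentChart (γ t)).symm (cotangentChart (γ t) (Γ s)))
      (Icc a b) t :=
    ContinuousAt.comp_continuousWithinAt (g := (cotangentChart (γ t)).symm)
      (f := fun s => cotangentChart (γ t) (Γ s))
      (continuousAt_extChartAt_symm'' ((cotangentChart (γ t)).map_source (hmem t hx)))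
      hder.continuousWithinAt
  refine h1.congr_of_eventuallyEq ?_ ((cotangentChart (γ t)).left_inv (hmem t hx)).symm
  filter_upwards [hev] with s hs using ((cotangentChart (γ t)).left_inv (hmem s hs.2)).symm

end Geodesic

end Charts

end Maupertuis

theorem theorem1p4 {d : ℕ} {M : Type*} [TopologicalSpace M] [T2Space M]
    [SecondCountableTopology M] [ChartedSpace (Model d) M] [IsManifold (𝓡 d) ∞ M]
    (h : CotangentBundle d M → ℝ)
    (h_smooth : ContMDiff (cotangentModel d) 𝓘(ℝ, ℝ) ∞ h)
    (h_hyperregular : Hyperregular h)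
    (h_even : ∀ (x : M) (ξ : CotangentSpace d x), h ⟨x, -ξ⟩ = h ⟨x, ξ⟩)
    (h_convex : ∀ x : M, StrictConvexOn ℝ univ (fun ξ : CotangentSpace d x => h ⟨x, ξ⟩))
    (h_bdd : BddAbove (range fun x : M => h ⟨x, 0⟩))
    (E a b : ℝ) (hab : a < b) :
    (∀ γ : ℝ → M,
      (∀ t ∈ Icc a b, γ t ∈ regularSet h E) →
      IsBaseIntegralCurve h a b γ →
      (∀ t ∈ Icc a b, energy h (γ t) (velocity a b γ t) = E) →
        IsFinslerGeodesic (finslerFunction h E) (regularSet h E) a b γ) ∧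
    (∀ γ : ℝ → M,
      IsFinslerGeodesic (finslerFunction h E) (regularSet h E) a b γ →
      (∀ t ∈ Icc a b, energy h (γ t) (velocity a b γ t) = E) →
        IsBaseIntegralCurve h a b γ) := by
  have hC := isLegendreChart_chartHam h_smooth h_hyperregular h_even h_convex
  exact ⟨fun γ => isFinslerGeodesic_of_isBaseIntegralCurve h_smooth hC hab,
    fun γ => isBaseIntegralCurve_of_isFinslerGeodesic h_smooth hC hab⟩
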